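/- Consider $n\ge 1$ agents and the decentralized stochastic bilevel problem with $F=\frac1n\sum_i f_i$, $G=\frac1n\sum_i g_i$ on $\mathbb R^{d_x}\times\mathbb R^{d_y}$, where $f_i(x,y)=\mathbb E[f_i(x,y;\xi_{f,i})]$ and $g_i(x,y)=\mathbb E[g_i(x,y;\xi_{g,i})]$. Assume that: 1. $F\ge \underline F$; each $f_i$ (resp. $g_i$) is $C^1$ with $L_1$-Lipschitz (resp. $L_2$-Lipschitz, $L_2>0$) gradient in $(x,y)$. 2. The sample gradients $\nabla f_i(x,y;\xi_{f,i})$ and $\nabla g_i(x,y;\xi_{g,i})$ are unbiased estimators of $\nabla f_i(x,y)$ and $\nabla g_i(x,y)$ with variances at most $\delta_f^2$ and $\delta_g^2$. 3. $\mathbf W=(w_{ij})\in\mathbb R^{n\times n}$ is non-negative, symmetric and doubly stochastic with eigenvalues $1=\lambda_1\ge\lambda_2\ge\dots\ge\lambda_n$, and $\rho:=\max\{|\lambda_2|,|\lambda_n|\}<1$ ($\rho:=0$ if $n=1$). 4. $\frac1n\sum_i\|\nabla f_i-\nabla F\|^2\le\sigma_f^2$ and $\frac1n\sum_i\|\nabla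 g_i-\nabla G\|^2\le\sigma_g^2$ everywhere. For $\gamma\in(0,\frac1{2L_2})$ let $V_\gamma(x,y)=\min_\theta\{G(x,\theta)+\frac1{2\gamma}\|\theta-y\|^2\}$, let $\theta^*_\gamma(x,y)$ be the unique minimizer, and let $\Psi_\mu=\mu F+G-V_\gamma$. Let $\mu_k=\mu_0(k+1)^{-p}$ with $\mu_0>0$ and $p\in[0,1/4)$, so that $p=0$ gives the fixed penalty parameter $\mu_k=\mu_0$. SUN-DSBO-SE with penalty parameters $\mu_k$ starts from deterministic $\theta_i^0,x_i^0,y_i^0$ and iterates, for $k=0,\dots,K-1$, $$(\theta_i^{k+1},x_i^{k+1},y_i^{k+1})=\sum_{j}w_{ij}\big(\theta_j^k-\lambda_\theta\hat D_{\theta,j}^k,\;x_j^k-\lambda_x\hat D_{x,j}^k,\;y_j^k-\lambda_y\hat D_{y,j}^k\big),$$ $$\hat D_{\theta,i}^k=\nabla_yg_i(x_i^k,\theta_i^k;\xi_{g,i}^k)+\tfrac1\gamma(\theta_i^k-y_i^k),$$ $$\hat D_{x,i}^k=\mu_k\nabla_xf_i(x_i^k,y_i^k;\xi_{f,i}^k)+\nabla_xg_i(x_i^k,y_i^k;\xi_{g,i}^k)-\nabla_xg_i(x_i^k,\theta_i^k;\xi_{g,i}^k),$$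 $$\hat D_{y,i}^k=\mu_k\nabla_yf_i(x_i^k,y_i^k;\xi_{f,i}^k)+\nabla_yg_i(x_i^k,y_i^k;\xi_{g,i}^k)-\tfrac1\gamma(y_i^k-\theta_i^k),$$ where the pairs $(\xi_{f,i}^k,\xi_{g,i}^k)$ are independent over $i$ and $k$ and have the prescribed marginal laws. Bars denote averages over the agents. The learning rates are $\lambda_\theta=c_\theta n^{1/2}K^{-1/2}$ and $\lambda_x=\lambda_y=c_\lambda\lambda_\theta$, with $c_\theta>0$, $0<c_\lambda\le\frac{\eta}{32a_1L_\theta^2}$, $\eta=\frac1\gamma-L_2$, $L_\theta=\eta^{-1}\sqrt{L_2^2+\gamma^{-2}}$ and $a_1=\frac1{2L_\theta}\sqrt{L_2^2+\gamma^{-2}}$. Then there is $\tau>0$, depending only on $(L_1,L_2,\gamma,\mu_0,c_\lambda)$, such that for every $c_\theta>0$ there is $C>0$, depending only on $(L_1,L_2,\gamma,\mu_0,c_\lambda,c_\theta)$, with the following property. For all other data as above (in particular all $n$, $\rho$, $p$, $\delta_f,\delta_g,\sigma_f,\sigma_g\ge0$), every $D$ with $$\mu_0\big(F(\bar x^0,\bar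 y^0)-\underline F\big)+G(\bar x^0,\bar y^0)-V_\gamma(\bar x^0,\bar y^0)+\|\bar\theta^0-\theta^*_\gamma(\bar x^0,\bar y^0)\|^2+\Delta^0\le D,$$ $\Delta^0=\frac1n\sum_i(\|x_i^0-\bar x^0\|^2+\|y_i^0-\bar y^0\|^2+\|\theta_i^0-\bar\theta^0\|^2)$, and every $K\ge1$ with $\lambda_\theta\le\tau(1-\rho)$: for each $k<K$ the function $\Psi_{\mu_k}$ is differentiable and $\mathbb E\|\nabla\Psi_{\mu_k}(\bar x^k,\bar y^k)\|^2<\infty$, and $$\frac1K\sum_{k=0}^{K-1}\mathbb E\|\nabla\Psi_{\mu_k}(\bar x^k,\bar y^k)\|^2\le C\left(\frac{\mathcal C_1}{n^{1/2}K^{1/2}}+\frac{n(\delta_f^2+\delta_g^2)}{(1-\rho)^2K}+\frac{n(\sigma_f^2+\sigma_g^2)}{(1-\rho)^2K}\right),\qquad \mathcal C_1=D+\delta_f^2+\delta_g^2 .$$ -/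

import Mathlib

open MeasureTheory ProbabilityTheory
open scoped NNReal Gradient

noncomputable section

namespace DSBO

/-- The Euclidean space `ℝ^d`. -/
abbrev Vec (d : ℕ) := EuclideanSpace ℝ (Fin d)

/-- `ℝ^dx × ℝ^dy` with the Euclidean norm `‖(x, y)‖² = ‖x‖² + ‖y‖²`. -/
abbrev Pair (dx dy : ℕ) := WithLp 2 (Vec dx × Vec dy)

/-- The point `(x, y)`. -/
def pair {dx dy : ℕ} (x : Vec dx) (y : Vec dy) : Pair dx dy := WithLp.toLp 2 (x, y)

/-- The average of a family over the `n` agents. -/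
def avg {n : ℕ} {E : Type*} [AddCommGroup E] [Module ℝ E] (v : Fin n → E) : E :=
  (n : ℝ)⁻¹ • ∑ i, v i

/-- The data of a decentralized stochastic bilevel problem with `n` agents: for every agent `i`
the laws of its samples `ξ_{f,i}`, `ξ_{g,i}` and its sample objectives
`f_i(x, y; ξ_{f,i})` and `g_i(x, y; ξ_{g,i})`. -/
structure Problem (n dx dy : ℕ) (Ξf Ξg : Type*) [MeasurableSpace Ξf] [MeasurableSpace Ξg] where
  lawF : Fin n → Measure Ξf
  lawG : Fin n → Measure Ξg
  sampleF : Fin n → Pair dx dy → Ξf → ℝ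
  sampleG : Fin n → Pair dx dy → Ξg → ℝ

/-- The local variables `θ_i, x_i, y_i` of all the agents. -/
structure State (n dx dy : ℕ) where
  θ : Fin n → Vec dy
  x : Fin n → Vec dx
  y : Fin n → Vec dy

namespace State

variable {n dx dy : ℕ}

/-- `(x̄, ȳ)`. -/
def mean (s : State n dx dy) : Pair dx dy := pair (avg s.x) (avg s.y)

/-- `(1/n) ∑ᵢ (‖x_i - x̄‖² + ‖y_i - ȳ‖² + ‖θ_i - θ̄‖²)`. -/
def consensusError (s : State n dx dy) : ℝ :=
  avg fun i => ‖s.x i - avg s.x‖ ^ 2 + ‖s.y i - avg s.y‖ ^ 2 + ‖s.θ i - avg s.θ‖ ^ 2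

end State

namespace Problem

variable {n dx dy : ℕ} {Ξf Ξg : Type*} [MeasurableSpace Ξf] [MeasurableSpace Ξg]
variable (Q : Problem n dx dy Ξf Ξg)

/-- `f_i(x, y) = E[f_i(x, y; ξ_{f,i})]`. -/
def f (i : Fin n) (z : Pair dx dy) : ℝ := ∫ ξ, Q.sampleF i z ξ ∂Q.lawF i

/-- `g_i(x, y) = E[g_i(x, y; ξ_{g,i})]`. -/
def g (i : Fin n) (z : Pair dx dy) : ℝ := ∫ ξ, Q.sampleG i z ξ ∂Q.lawG i

/-- The upper-level objective. -/
def F (z : Pair dx dy) : ℝ := avg fun i => Q.f i z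

/-- The lower-level objective. -/
def G (z : Pair dx dy) : ℝ := avg fun i => Q.g i z

/-- `G(x, θ) + ‖θ - y‖² / (2γ)` at `z = (x, y)`. -/
def proxObjective (γ : ℝ) (z : Pair dx dy) (θ : Vec dy) : ℝ :=
  Q.G (pair z.fst θ) + 1 / (2 * γ) * ‖θ - z.snd‖ ^ 2

/-- The Moreau envelope `V_γ(x, y) = min_θ {G(x, θ) + ‖θ - y‖² / (2γ)}`. -/
def moreau (γ : ℝ) (z : Pair dx dy) : ℝ := ⨅ θ : Vec dy, Q.proxObjective γ z θ

/-- `θ*_γ(x, y)`, the minimizer in the definition of the Moreau envelope. -/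
def proxPoint (γ : ℝ) (z : Pair dx dy) : Vec dy :=
  Classical.epsilon fun θ => ∀ θ' : Vec dy, Q.proxObjective γ z θ ≤ Q.proxObjective γ z θ'

/-- The penalty function `Ψ_μ = μ F + G - V_γ`. -/
def Psi (γ μ : ℝ) (z : Pair dx dy) : ℝ := μ * Q.F z + Q.G z - Q.moreau γ z

/-- The stochastic gradient `∇ f_i(x, y; ξ)`. -/
def gradF (i : Fin n) (z : Pair dx dy) (ξ : Ξf) : Pair dx dy :=
  ∇ (fun w => Q.sampleF i w ξ) z

/-- The stochastic gradient `∇ g_i(x, y; ξ)`. -/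
def gradG (i : Fin n) (z : Pair dx dy) (ξ : Ξg) : Pair dx dy :=
  ∇ (fun w => Q.sampleG i w ξ) z

/-- Smoothness: `f_i` and `g_i` are continuously differentiable with `L1`- and `L2`-Lipschitz
gradients. -/
structure IsSmooth (L1 L2 : ℝ≥0) : Prop where
  contDiff_f : ∀ i, ContDiff ℝ 1 (Q.f i)
  contDiff_g : ∀ i, ContDiff ℝ 1 (Q.g i)
  lipschitz_f : ∀ i, LipschitzWith L1 (∇ (Q.f i))
  lipschitz_g : ∀ i, LipschitzWith L2 (∇ (Q.g i))

/-- Stochastic oracle: the stochastic gradients are unbiased estimators of `∇ f_i` and `∇ g_i`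
with variances at most `δf ^ 2` and `δg ^ 2`. -/
structure IsStochasticOracle (δf δg : ℝ) : Prop where
  isProbabilityMeasure_f : ∀ i, IsProbabilityMeasure (Q.lawF i)
  isProbabilityMeasure_g : ∀ i, IsProbabilityMeasure (Q.lawG i)
  integrable_sampleF : ∀ i z, Integrable (Q.sampleF i z) (Q.lawF i)
  integrable_sampleG : ∀ i z, Integrable (Q.sampleG i z) (Q.lawG i)
  differentiable_f : ∀ i ξ, Differentiable ℝ fun z => Q.sampleF i z ξ
  differentiable_g : ∀ i ξ, Differentiable ℝ fun z => Q.sampleG i z ξ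
  measurable_f : ∀ i, Measurable fun q : Pair dx dy × Ξf => Q.gradF i q.1 q.2
  measurable_g : ∀ i, Measurable fun q : Pair dx dy × Ξg => Q.gradG i q.1 q.2
  unbiased_f : ∀ i z, ∫ ξ, Q.gradF i z ξ ∂Q.lawF i = ∇ (Q.f i) z
  unbiased_g : ∀ i z, ∫ ξ, Q.gradG i z ξ ∂Q.lawG i = ∇ (Q.g i) z
  integrable_variance_f : ∀ i z, Integrable (fun ξ => ‖∇ (Q.f i) z - Q.gradF i z ξ‖ ^ 2) (Q.lawF i)
  integrable_variance_g : ∀ i z, Integrable (fun ξ => ‖∇ (Q.g i) z - Q.gradG i z ξ‖ ^ 2) (Q.lawG i)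
  variance_f : ∀ i z, ∫ ξ, ‖∇ (Q.f i) z - Q.gradF i z ξ‖ ^ 2 ∂Q.lawF i ≤ δf ^ 2
  variance_g : ∀ i z, ∫ ξ, ‖∇ (Q.g i) z - Q.gradG i z ξ‖ ^ 2 ∂Q.lawG i ≤ δg ^ 2

/-- Bounded gradient dissimilarity. -/
structure HasBoundedDissimilarity (σf σg : ℝ) : Prop where
  bound_f : ∀ z, (avg fun i => ‖∇ (Q.f i) z - ∇ Q.F z‖ ^ 2) ≤ σf ^ 2
  bound_g : ∀ z, (avg fun i => ‖∇ (Q.g i) z - ∇ Q.G z‖ ^ 2) ≤ σg ^ 2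

/-- The samples `ξ_{f,i}^k`, `ξ_{g,i}^k` drawn by agent `i` at iteration `k`: they have the laws
prescribed by the problem, and the pairs `ζ_i^k = (ξ_{f,i}^k, ξ_{g,i}^k)` are independent over
agents and iterations. -/
structure IsSampling {Ω : Type*} [MeasurableSpace Ω] (P : Measure Ω)
    (ξf : Fin n → ℕ → Ω → Ξf) (ξg : Fin n → ℕ → Ω → Ξg) : Prop where
  measurable_f : ∀ i k, Measurable (ξf i k)
  measurable_g : ∀ i k, Measurable (ξg i k)
  law_f : ∀ i k, P.map (ξf i k) = Q.lawF i
  law_g : ∀ i k, P.map (ξg i k) = Q.lawG i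
  indep : iIndepFun (fun (ik : Fin n × ℕ) ω => (ξf ik.1 ik.2 ω, ξg ik.1 ik.2 ω)) P

section Algorithm

variable (γ μ : ℝ) (s : State n dx dy)

/-- `∇_y g_i(x_i, θ_i; ξ_{g,i}) + (θ_i - y_i) / γ`. -/
def dirθ (ξg : Ξg) (i : Fin n) : Vec dy :=
  (Q.gradG i (pair (s.x i) (s.θ i)) ξg).snd + (1 / γ) • (s.θ i - s.y i)

/-- `μ ∇_x f_i(x_i, y_i; ξ_{f,i}) + ∇_x g_i(x_i, y_i; ξ_{g,i}) - ∇_x g_i(x_i, θ_i; ξ_{g,i})`. -/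
def dirx (ξf : Ξf) (ξg : Ξg) (i : Fin n) : Vec dx :=
  μ • (Q.gradF i (pair (s.x i) (s.y i)) ξf).fst + (Q.gradG i (pair (s.x i) (s.y i)) ξg).fst
    - (Q.gradG i (pair (s.x i) (s.θ i)) ξg).fst

/-- `μ ∇_y f_i(x_i, y_i; ξ_{f,i}) + ∇_y g_i(x_i, y_i; ξ_{g,i}) - (y_i - θ_i) / γ`. -/
def diry (ξf : Ξf) (ξg : Ξg) (i : Fin n) : Vec dy :=
  μ • (Q.gradF i (pair (s.x i) (s.y i)) ξf).snd + (Q.gradG i (pair (s.x i) (s.y i)) ξg).snd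
    - (1 / γ) • (s.y i - s.θ i)

/-- One iteration of SUN-DSBO-SE, with the samples `ξf j`, `ξg j` of the agents `j`. -/
def step (W : Matrix (Fin n) (Fin n) ℝ) (lθ lx ly : ℝ) (ξf : Fin n → Ξf) (ξg : Fin n → Ξg) :
    State n dx dy where
  θ i := ∑ j, W i j • (s.θ j - lθ • Q.dirθ γ s (ξg j) j)
  x i := ∑ j, W i j • (s.x j - lx • Q.dirx μ s (ξf j) (ξg j) j)
  y i := ∑ j, W i j • (s.y j - ly • Q.diry γ μ s (ξf j) (ξg j) j)

end Algorithm

/-- SUN-DSBO-SE: the iterates with weight matrix `W`, penalty parameters `μ k`, learning rates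
`lθ k`, `lx k`, `ly k`, initial state `s0`, and samples `ξf i k`, `ξg i k`. -/
def sunDsboSE (γ : ℝ) (W : Matrix (Fin n) (Fin n) ℝ) (μ lθ lx ly : ℕ → ℝ) (s0 : State n dx dy)
    (ξf : Fin n → ℕ → Ξf) (ξg : Fin n → ℕ → Ξg) : ℕ → State n dx dy
  | 0 => s0
  | k + 1 => Q.step γ (μ k) (sunDsboSE γ W μ lθ lx ly s0 ξf ξg k) W (lθ k) (lx k) (ly k)
      (fun i => ξf i k) (fun i => ξg i k)

/-- The initial level
`μ (F(x̄⁰,ȳ⁰) - F_low) + G(x̄⁰,ȳ⁰) - V_γ(x̄⁰,ȳ⁰) + ‖θ̄⁰ - θ*_γ(x̄⁰,ȳ⁰)‖² + Δ⁰`. -/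
def initialLevel (γ μ Flow : ℝ) (s0 : State n dx dy) : ℝ :=
  μ * (Q.F s0.mean - Flow) + Q.G s0.mean - Q.moreau γ s0.mean
    + ‖avg s0.θ - Q.proxPoint γ s0.mean‖ ^ 2 + s0.consensusError

end Problem

/-- The weight matrix is non-negative, symmetric and doubly stochastic. -/
structure IsWeightMatrix {n : ℕ} (W : Matrix (Fin n) (Fin n) ℝ) : Prop where
  doublyStochastic : W ∈ doublyStochastic ℝ (Fin n)
  isHermitian : W.IsHermitian

/-- The connectivity parameter `ρ = max {|λ₂|, |λₙ|}`, where `λ₁ ≥ λ₂ ≥ ⋯ ≥ λₙ` are the eigenvalues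
of `W` (with indices starting at `0` in the code); it is `0` for a single agent. -/
def connectivity {n : ℕ} (W : Matrix (Fin n) (Fin n) ℝ) (hW : W.IsHermitian) : ℝ :=
  if h : 2 ≤ n then
    max |hW.eigenvalues₀ ⟨1, by rw [Fintype.card_fin]; omega⟩|
      |hW.eigenvalues₀ ⟨n - 1, by rw [Fintype.card_fin]; omega⟩|
  else 0

/-- The Lipschitz constant `L_θ = √(L₂² + γ⁻²) / (γ⁻¹ - L₂)` of `θ*_γ`. -/
def Lθ (L2 γ : ℝ) : ℝ := √(L2 ^ 2 + 1 / γ ^ 2) / (1 / γ - L2)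

/-- `a₁ = √(L₂² + γ⁻²) / (2 L_θ)`. -/
def a1 (L2 γ : ℝ) : ℝ := 1 / (2 * Lθ L2 γ) * √(L2 ^ 2 + 1 / γ ^ 2)

end DSBO

end

noncomputable section

namespace DSBO

section Smooth

theorem continuous_of_differentiable {E : Type*} [NormedAddCommGroup E] [NormedSpace ℝ E]
    {f : E → ℝ} (h : Differentiable ℝ f) : Continuous f := h.continuous

variable {E : Type*} [NormedAddCommGroup E] [InnerProductSpace ℝ E] [CompleteSpace E]

/-- First-order expansion of a function with Lipschitz gradient. -/
theorem abs_expansion_le_of_lipschitz_gradient {f : E → ℝ} {L : ℝ≥0} (hf : Differentiable ℝ f)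
    (hL : LipschitzWith L (∇ f)) (z u : E) :
    |f (z + u) - f z - inner ℝ (∇ f z) u| ≤ L * ‖u‖ ^ 2 := by
  have hd : ∀ w ∈ segment ℝ z (z + u), HasFDerivWithinAt
      (fun w => f w - inner ℝ (∇ f z) w) (fderiv ℝ f w - innerSL ℝ (∇ f z))
      (segment ℝ z (z + u)) w := fun w _ =>
    ((hf w).hasFDerivAt.sub (innerSL ℝ (∇ f z)).hasFDerivAt).hasFDerivWithinAt
  have hb : ∀ w ∈ segment ℝ z (z + u), ‖fderiv ℝ f w - innerSL ℝ (∇ f z)‖ ≤ L * ‖u‖ := by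
    intro w hw
    obtain ⟨t, ht, rfl⟩ := (segment_eq_image' ℝ z (z + u) ▸ hw)
    have h1 : fderiv ℝ f (z + t • (z + u - z)) - innerSL ℝ (∇ f z)
        = InnerProductSpace.toDual ℝ E (∇ f (z + t • (z + u - z)) - ∇ f z) := by
      rw [map_sub, toDual_gradient]; rfl
    rw [h1, LinearIsometryEquiv.norm_map, ← dist_eq_norm]
    refine (hL.dist_le_mul _ _).trans ?_
    gcongr
    rw [dist_eq_norm, add_sub_cancel_left, norm_smul, add_sub_cancel_left, Real.norm_eq_abs,
      abs_of_nonneg ht.1]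
    exact mul_le_of_le_one_left (norm_nonneg _) ht.2
  have := (convex_segment z (z + u)).norm_image_sub_le_of_norm_hasFDerivWithin_le hd hb
    (left_mem_segment ℝ _ _) (right_mem_segment ℝ _ _)
  rw [Real.norm_eq_abs, add_sub_cancel_left, inner_add_right] at this
  calc _ = |f (z + u) - (inner ℝ (∇ f z) z + inner ℝ (∇ f z) u) - (f z - inner ℝ (∇ f z) z)| := by
        congr 1; ring
    _ ≤ _ := by rw [pow_two, ← mul_assoc]; exact this

theorem differentiable_of_hasGradientAt {f : E → ℝ} {f' : E → E}
    (h : ∀ z, HasGradientAt f (f' z) z) : Differentiable ℝ f :=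
  fun z => (h z).differentiableAt

theorem hasGradientAt_gradient {f : E → ℝ} (h : Differentiable ℝ f) (z : E) :
    HasGradientAt f (∇ f z) z := (h z).hasGradientAt

/-- A first-order expansion with quadratic error identifies the gradient. -/
theorem hasGradientAt_of_abs_expansion_le {f : E → ℝ} {z v : E} {M : ℝ}
    (h : ∀ u, |f (z + u) - f z - inner ℝ v u| ≤ M * ‖u‖ ^ 2) : HasGradientAt f v z := by
  rw [hasGradientAt_iff_isLittleO_nhds_zero]
  have h1 : (fun u : E => f (z + u) - f z - inner ℝ v u) =O[nhds 0] fun u => ‖u‖ ^ 2 :=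
    Asymptotics.IsBigO.of_bound M (Filter.Eventually.of_forall fun u => by
      simpa using h u)
  exact h1.trans_isLittleO (Asymptotics.isLittleO_norm_pow_id one_lt_two)

theorem hasGradientAt_avg {n : ℕ} {f : Fin n → E → ℝ} (hf : ∀ i, Differentiable ℝ (f i)) (z : E) :
    HasGradientAt (fun w => avg fun i => f i w) (avg fun i => ∇ (f i) z) z := by
  rw [hasGradientAt_iff_hasFDerivAt]
  have h1 : HasFDerivAt (fun w => ∑ i, f i w) (∑ i, fderiv ℝ (f i) z) z :=
    HasFDerivAt.fun_sum fun i _ => (hf i z).hasFDerivAt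
  have h2 := h1.const_smul (n : ℝ)⁻¹
  convert! h2 using 1
  simp [avg, map_sum, map_smul, toDual_gradient]

end Smooth

section Avg

variable {n : ℕ} {E : Type*} [NormedAddCommGroup E] [InnerProductSpace ℝ E]

theorem avg_add (u v : Fin n → E) : (avg fun i => u i + v i) = avg u + avg v := by
  simp [avg, Finset.sum_add_distrib]

theorem avg_sub (u v : Fin n → E) : (avg fun i => u i - v i) = avg u - avg v := by
  simp [avg, Finset.sum_sub_distrib, smul_sub]

theorem avg_smul (c : ℝ) (v : Fin n → E) : (avg fun i => c • v i) = c • avg v := by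
  simp only [avg, ← Finset.smul_sum, smul_comm c]

theorem avg_const (hn : 0 < n) (c : E) : (avg fun _ : Fin n => c) = c := by
  have : (n : ℝ) ≠ 0 := by positivity
  simp [avg, ← Nat.cast_smul_eq_nsmul ℝ, smul_smul, this]

theorem avg_mono {u v : Fin n → ℝ} (h : ∀ i, u i ≤ v i) : avg u ≤ avg v := by
  unfold avg
  simp only [smul_eq_mul]
  gcongr with i
  exact h i

theorem avg_nonneg {u : Fin n → ℝ} (h : ∀ i, 0 ≤ u i) : 0 ≤ avg u := by
  unfold avg
  have := Finset.sum_nonneg fun i (_ : i ∈ Finset.univ) => h i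
  simp only [smul_eq_mul]
  positivity

theorem norm_avg_sq_le (v : Fin n → E) : ‖avg v‖ ^ 2 ≤ avg fun i => ‖v i‖ ^ 2 := by
  rcases Nat.eq_zero_or_pos n with rfl | hn
  · simp [avg]
  have hn' : (0 : ℝ) < n := by positivity
  have h1 : ‖∑ i, v i‖ ^ 2 ≤ n * ∑ i, ‖v i‖ ^ 2 := by
    calc _ ≤ (∑ i, ‖v i‖) ^ 2 := by gcongr; exact norm_sum_le _ _
      _ ≤ _ := by simpa using sq_sum_le_card_mul_sum_sq (s := Finset.univ) (f := fun i => ‖v i‖)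
  unfold avg
  rw [norm_smul, mul_pow, norm_inv, Real.norm_natCast, smul_eq_mul]
  calc _ ≤ ((n : ℝ)⁻¹) ^ 2 * (n * ∑ i, ‖v i‖ ^ 2) := by gcongr
    _ = _ := by field_simp

/-- The average minimizes the mean squared distance. -/
theorem avg_norm_sub_avg_sq_le (v : Fin n → E) (c : E) :
    (avg fun i => ‖v i - avg v‖ ^ 2) ≤ avg fun i => ‖v i - c‖ ^ 2 := by
  rcases Nat.eq_zero_or_pos n with rfl | hn
  · simp [avg]
  have h : ∀ i, ‖v i - c‖ ^ 2 = ‖v i - avg v‖ ^ 2 + ‖avg v - c‖ ^ 2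
      + 2 * inner ℝ (v i - avg v) (avg v - c) := fun i => by
    rw [← sub_add_sub_cancel (v i) (avg v) c, norm_add_sq_real]; ring
  have h0 : (avg fun i => inner ℝ (v i - avg v) (avg v - c)) = 0 := by
    have : (avg fun i => v i - avg v) = 0 := by
      rw [avg_sub v fun _ => avg v, avg_const hn, sub_self]
    rw [← inner_zero_left (𝕜 := ℝ) (avg v - c), ← this]
    generalize avg v - c = d
    generalize avg v = m
    simp only [avg, real_inner_smul_left, sum_inner, smul_eq_mul]
  have h2 : (avg fun i => ‖v i - c‖ ^ 2) = (avg fun i => ‖v i - avg v‖ ^ 2) + ‖avg v - c‖ ^ 2 := by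
    have e1 := avg_add (fun i => ‖v i - avg v‖ ^ 2 + ‖avg v - c‖ ^ 2)
      (fun i => (2 : ℝ) • inner ℝ (v i - avg v) (avg v - c))
    have e2 := avg_add (fun i => ‖v i - avg v‖ ^ 2) (fun _ => ‖avg v - c‖ ^ 2)
    rw [e2, avg_const hn, avg_smul, h0] at e1
    simp only [h]
    simpa using e1
  rw [h2]
  have := sq_nonneg ‖avg v - c‖
  linarith

end Avg

section Pair

variable {dx dy : ℕ}

theorem norm_pair_sq (x : Vec dx) (y : Vec dy) : ‖pair x y‖ ^ 2 = ‖x‖ ^ 2 + ‖y‖ ^ 2 :=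
  WithLp.prod_norm_sq_eq_of_L2 _

theorem norm_sq_eq_fst_add_snd (z : Pair dx dy) : ‖z‖ ^ 2 = ‖z.fst‖ ^ 2 + ‖z.snd‖ ^ 2 :=
  WithLp.prod_norm_sq_eq_of_L2 _

theorem norm_fst_le (z : Pair dx dy) : ‖z.fst‖ ≤ ‖z‖ := by
  have := norm_sq_eq_fst_add_snd z
  exact abs_le_of_sq_le_sq' (by nlinarith [sq_nonneg ‖z.snd‖]) (norm_nonneg _) |>.2

theorem norm_snd_le (z : Pair dx dy) : ‖z.snd‖ ≤ ‖z‖ := by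
  have := norm_sq_eq_fst_add_snd z
  exact abs_le_of_sq_le_sq' (by nlinarith [sq_nonneg ‖z.fst‖]) (norm_nonneg _) |>.2

theorem inner_pair_eq (z w : Pair dx dy) :
    inner ℝ z w = inner ℝ z.fst w.fst + inner ℝ z.snd w.snd := WithLp.prod_inner_apply _ _

theorem pair_ext {z w : Pair dx dy} (h1 : z.fst = w.fst) (h2 : z.snd = w.snd) : z = w :=
  WithLp.ofLp_injective 2 (Prod.ext h1 h2)

@[simp] theorem pair_fst (x : Vec dx) (y : Vec dy) : (pair x y).fst = x := rfl
@[simp] theorem pair_snd (x : Vec dx) (y : Vec dy) : (pair x y).snd = y := rfl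

theorem continuous_pair : Continuous fun q : Vec dx × Vec dy => pair q.1 q.2 :=
  WithLp.prod_continuous_toLp 2 _ _

end Pair

namespace Problem

variable {n dx dy : ℕ} {Ξf Ξg : Type*} [MeasurableSpace Ξf] [MeasurableSpace Ξg]
variable {Q : Problem n dx dy Ξf Ξg} {L1 L2 : ℝ≥0} {γ : ℝ}

section Averages

theorem IsSmooth.differentiable_f (h : Q.IsSmooth L1 L2) (i : Fin n) : Differentiable ℝ (Q.f i) :=
  (h.contDiff_f i).differentiable one_ne_zero

theorem IsSmooth.differentiable_g (h : Q.IsSmooth L1 L2) (i : Fin n) : Differentiable ℝ (Q.g i) :=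
  (h.contDiff_g i).differentiable one_ne_zero

theorem IsSmooth.hasGradientAt_F (h : Q.IsSmooth L1 L2) (z : Pair dx dy) :
    HasGradientAt Q.F (avg fun i => ∇ (Q.f i) z) z := hasGradientAt_avg h.differentiable_f z

theorem IsSmooth.hasGradientAt_G (h : Q.IsSmooth L1 L2) (z : Pair dx dy) :
    HasGradientAt Q.G (avg fun i => ∇ (Q.g i) z) z := hasGradientAt_avg h.differentiable_g z

theorem IsSmooth.differentiable_F (h : Q.IsSmooth L1 L2) : Differentiable ℝ Q.F :=
  fun z => (h.hasGradientAt_F z).differentiableAt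

theorem IsSmooth.differentiable_G (h : Q.IsSmooth L1 L2) : Differentiable ℝ Q.G :=
  fun z => (h.hasGradientAt_G z).differentiableAt

theorem norm_avg_sub_avg_sq_le_of_lipschitz {E E' : Type*} [NormedAddCommGroup E]
    [InnerProductSpace ℝ E] [NormedAddCommGroup E'] [InnerProductSpace ℝ E']
    {φ : Fin n → E → E'} {L : ℝ≥0} (h : ∀ i, LipschitzWith L (φ i)) (z w : Fin n → E) :
    ‖(avg fun i => φ i (z i)) - avg fun i => φ i (w i)‖ ^ 2
      ≤ L ^ 2 * avg fun i => ‖z i - w i‖ ^ 2 := by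
  rw [← avg_sub]
  refine (norm_avg_sq_le _).trans ?_
  rw [← smul_eq_mul, ← avg_smul]
  refine avg_mono fun i => ?_
  rw [smul_eq_mul, ← mul_pow]
  gcongr
  simpa [dist_eq_norm] using (h i).dist_le_mul (z i) (w i)

theorem lipschitzWith_avg (hn : 0 < n) {E E' : Type*} [NormedAddCommGroup E]
    [InnerProductSpace ℝ E] [NormedAddCommGroup E'] [InnerProductSpace ℝ E']
    {φ : Fin n → E → E'} {L : ℝ≥0} (h : ∀ i, LipschitzWith L (φ i)) :
    LipschitzWith L fun z => avg fun i => φ i z :=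
  LipschitzWith.of_dist_le_mul fun z w => by
    have := norm_avg_sub_avg_sq_le_of_lipschitz h (fun _ => z) (fun _ => w)
    rw [avg_const hn, ← mul_pow] at this
    rw [dist_eq_norm, dist_eq_norm]
    exact (abs_le_of_sq_le_sq' this (by positivity)).2

theorem IsSmooth.lipschitz_F (h : Q.IsSmooth L1 L2) (hn : 0 < n) : LipschitzWith L1 (∇ Q.F) := by
  rw [show ∇ Q.F = _ from funext fun z => (h.hasGradientAt_F z).gradient]
  exact lipschitzWith_avg hn h.lipschitz_f

theorem IsSmooth.lipschitz_G (h : Q.IsSmooth L1 L2) (hn : 0 < n) : LipschitzWith L2 (∇ Q.G) := by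
  rw [show ∇ Q.G = _ from funext fun z => (h.hasGradientAt_G z).gradient]
  exact lipschitzWith_avg hn h.lipschitz_g

end Averages

variable (Q) in
/-- The gradient of `proxObjective` in `θ`. -/
def proxGrad (γ : ℝ) (z : Pair dx dy) (θ : Vec dy) : Vec dy :=
  (∇ Q.G (pair z.fst θ)).snd + (1 / γ) • (θ - z.snd)

variable (Q) in
/-- The gradient of `proxObjective` in `z`. -/
def envGrad (γ : ℝ) (z : Pair dx dy) (θ : Vec dy) : Pair dx dy :=
  pair (∇ Q.G (pair z.fst θ)).fst ((1 / γ) • (z.snd - θ))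

theorem abs_proxObjective_expansion_le (hG : Differentiable ℝ Q.G) (hL : LipschitzWith L2 (∇ Q.G))
    (hγ : 0 < γ) (z u : Pair dx dy) (θ w : Vec dy) :
    |Q.proxObjective γ (z + u) (θ + w) - Q.proxObjective γ z θ - inner ℝ (Q.envGrad γ z θ) u
      - inner ℝ (Q.proxGrad γ z θ) w| ≤ (L2 + 1 / γ) * (‖u‖ ^ 2 + ‖w‖ ^ 2) := by
  have h1 := abs_expansion_le_of_lipschitz_gradient hG hL (pair z.fst θ) (pair u.fst w)
  have e1 : pair z.fst θ + pair u.fst w = pair (z + u).fst (θ + w) := rfl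
  have hq : ‖θ + w - (z + u).snd‖ ^ 2 = ‖θ - z.snd‖ ^ 2 + 2 * inner ℝ (θ - z.snd) w
      - 2 * inner ℝ (θ - z.snd) u.snd + ‖w - u.snd‖ ^ 2 := by
    have : θ + w - (z + u).snd = (θ - z.snd) + (w - u.snd) := by
      rw [WithLp.add_snd]; abel
    rw [this, norm_add_sq_real, inner_sub_right]; ring
  have hb : ‖w - u.snd‖ ^ 2 ≤ 2 * (‖u.snd‖ ^ 2 + ‖w‖ ^ 2) := by
    have := parallelogram_law_with_norm ℝ w u.snd
    nlinarith [sq_nonneg ‖w + u.snd‖]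
  have hu := norm_sq_eq_fst_add_snd u
  rw [e1, inner_pair_eq, norm_pair_sq, pair_fst, pair_snd] at h1
  have key : Q.proxObjective γ (z + u) (θ + w) - Q.proxObjective γ z θ
      - inner ℝ (Q.envGrad γ z θ) u - inner ℝ (Q.proxGrad γ z θ) w
      = (Q.G (pair (z + u).fst (θ + w)) - Q.G (pair z.fst θ)
        - (inner ℝ (∇ Q.G (pair z.fst θ)).fst u.fst + inner ℝ (∇ Q.G (pair z.fst θ)).snd w))
        + 1 / (2 * γ) * ‖w - u.snd‖ ^ 2 := by
    have : inner ℝ (z.snd - θ) u.snd = - inner ℝ (θ - z.snd) u.snd := by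
      rw [← inner_neg_left, neg_sub]
    simp only [proxObjective, envGrad, proxGrad]
    rw [hq, inner_pair_eq, pair_fst, pair_snd, inner_add_left, real_inner_smul_left,
      real_inner_smul_left, this]
    field_simp
    ring
  rw [key]
  refine (abs_add_le _ _).trans ?_
  have h2 : |1 / (2 * γ) * ‖w - u.snd‖ ^ 2| ≤ 1 / γ * (‖u‖ ^ 2 + ‖w‖ ^ 2) := by
    rw [abs_of_nonneg (by positivity)]
    calc _ ≤ 1 / (2 * γ) * (2 * (‖u.snd‖ ^ 2 + ‖w‖ ^ 2)) := by gcongr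
      _ = 1 / γ * (‖u.snd‖ ^ 2 + ‖w‖ ^ 2) := by field_simp
      _ ≤ _ := by gcongr; exact norm_snd_le u
  have h3 : (L2 : ℝ) * (‖u.fst‖ ^ 2 + ‖w‖ ^ 2) ≤ L2 * (‖u‖ ^ 2 + ‖w‖ ^ 2) := by
    gcongr; exact norm_fst_le u
  linarith

theorem continuous_proxObjective (hG : Differentiable ℝ Q.G) :
    Continuous fun q : Pair dx dy × Vec dy => Q.proxObjective γ q.1 q.2 := by
  have h1 : Continuous fun q : Pair dx dy × Vec dy => pair q.1.fst q.2 :=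
    continuous_pair.comp (f := fun q : Pair dx dy × Vec dy => (q.1.fst, q.2)) (by fun_prop)
  unfold proxObjective
  have h2 : Continuous fun q : Pair dx dy × Vec dy => q.2 - q.1.snd := by fun_prop
  have hc : Continuous Q.G := continuous_of_differentiable hG
  exact (hc.comp h1).add (continuous_const.mul (h2.norm.pow 2))

theorem exists_proxObjective_minimizer (hG : Differentiable ℝ Q.G) (hL : LipschitzWith L2 (∇ Q.G))
    (hγ' : L2 < 1 / (2 * γ)) (z : Pair dx dy) :
    ∃ θ, ∀ θ', Q.proxObjective γ z θ ≤ Q.proxObjective γ z θ' := by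
  refine Continuous.exists_forall_le
    ((continuous_proxObjective hG).comp (f := fun θ => (z, θ)) (by fun_prop)) ?_
  set b := ‖∇ Q.G z‖
  set c := 1 / (2 * γ) - L2
  have hc : 0 < c := sub_pos.2 hγ'
  have hlow : ∀ θ, Q.G z + ‖θ - z.snd‖ * (c * ‖θ - z.snd‖ - b) ≤ Q.proxObjective γ z θ := by
    intro θ
    have h1 := abs_expansion_le_of_lipschitz_gradient hG hL z (pair 0 (θ - z.snd))
    have e1 : z + pair 0 (θ - z.snd) = pair z.fst θ := pair_ext (by simp) (by simp)
    have h2 := abs_real_inner_le_norm (∇ Q.G z) (pair 0 (θ - z.snd))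
    have h3 : ‖(pair 0 (θ - z.snd) : Pair dx dy)‖ = ‖θ - z.snd‖ := by
      have := norm_pair_sq (0 : Vec dx) (θ - z.snd)
      rw [norm_zero, zero_pow two_ne_zero, zero_add] at this
      exact (sq_eq_sq₀ (norm_nonneg _) (norm_nonneg _)).1 this
    rw [h3] at h1 h2
    rw [e1] at h1
    have h4 := (abs_le.1 h1).1
    have h5 := (abs_le.1 h2).1
    unfold proxObjective
    have : ‖θ - z.snd‖ * (c * ‖θ - z.snd‖ - b)
      = 1 / (2 * γ) * ‖θ - z.snd‖ ^ 2 - L2 * ‖θ - z.snd‖ ^ 2 - b * ‖θ - z.snd‖ := by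
      simp only [c]; ring
    linarith
  refine Filter.tendsto_atTop_mono hlow ?_
  have hn : Filter.Tendsto (fun θ : Vec dy => ‖θ - z.snd‖) (Filter.cocompact _) Filter.atTop := by
    have := tendsto_dist_left_cocompact_atTop (α := Vec dy) z.snd
    exact this.congr fun θ => by rw [dist_eq_norm, norm_sub_rev]
  refine Filter.tendsto_atTop_add_const_left _ _ (hn.atTop_mul_atTop₀ ?_)
  exact Filter.tendsto_atTop_add_const_right _ _ (hn.const_mul_atTop hc)

variable (Q) in
/-- The assumptions under which the Moreau envelope of the lower-level objective is smooth. -/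
structure IsProxRegular (L2 : ℝ≥0) (γ : ℝ) : Prop where
  differentiable : Differentiable ℝ Q.G
  lipschitz : LipschitzWith L2 (∇ Q.G)
  pos : 0 < γ
  lt : L2 < 1 / (2 * γ)

namespace IsProxRegular

variable (h : Q.IsProxRegular L2 γ)
include h

theorem gap_pos : 0 < 1 / γ - L2 := by
  have := h.lt
  have h1 : 1 / γ = 2 * (1 / (2 * γ)) := by have := h.pos; field_simp
  have := L2.coe_nonneg
  linarith

theorem proxPoint_le (z : Pair dx dy) (θ : Vec dy) :
    Q.proxObjective γ z (Q.proxPoint γ z) ≤ Q.proxObjective γ z θ :=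
  Classical.epsilon_spec
    (exists_proxObjective_minimizer h.differentiable h.lipschitz h.lt z) θ

theorem moreau_eq (z : Pair dx dy) :
    Q.moreau γ z = Q.proxObjective γ z (Q.proxPoint γ z) :=
  le_antisymm (ciInf_le ⟨_, Set.forall_mem_range.2 (h.proxPoint_le z)⟩ _)
    (le_ciInf (h.proxPoint_le z))

theorem moreau_le (z : Pair dx dy) (θ : Vec dy) : Q.moreau γ z ≤ Q.proxObjective γ z θ :=
  (h.moreau_eq z).trans_le (h.proxPoint_le z θ)

theorem moreau_le_G (z : Pair dx dy) : Q.moreau γ z ≤ Q.G z := by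
  have := h.moreau_le z z.snd
  have e : pair z.fst z.snd = z := rfl
  rwa [proxObjective, sub_self, norm_zero, e, zero_pow two_ne_zero, mul_zero, add_zero] at this

theorem proxGrad_proxPoint (z : Pair dx dy) : Q.proxGrad γ z (Q.proxPoint γ z) = 0 := by
  set g := Q.proxGrad γ z (Q.proxPoint γ z)
  set M : ℝ := L2 + 1 / γ
  have hM : 0 < M := by have := h.pos; positivity
  have h1 := (abs_le.1 (abs_proxObjective_expansion_le h.differentiable h.lipschitz h.pos z 0
    (Q.proxPoint γ z) (-(1 / (2 * M)) • g))).2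
  have h2 := h.proxPoint_le z (Q.proxPoint γ z + -(1 / (2 * M)) • g)
  rw [add_zero, inner_zero_right, real_inner_smul_right, real_inner_self_eq_norm_sq, norm_zero,
    norm_smul, norm_neg, Real.norm_of_nonneg (by positivity)] at h1
  have h3 : 1 / (4 * M) * ‖g‖ ^ 2 ≤ 0 := by
    have e : (L2 + 1 / γ) * (0 ^ 2 + (1 / (2 * M) * ‖g‖) ^ 2) = 1 / (4 * M) * ‖g‖ ^ 2 := by
      change M * _ = _; field_simp; ring
    have e' : 1 / (2 * M) * ‖g‖ ^ 2 = 2 * (1 / (4 * M) * ‖g‖ ^ 2) := by field_simp; ring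
    linarith
  have h4 : ‖g‖ ^ 2 ≤ 0 := by
    by_contra! hc
    exact absurd h3 (not_le.2 (by positivity))
  simpa using le_antisymm h4 (sq_nonneg _)

theorem gap_mul_norm_sub_le (z : Pair dx dy) (θ θ' : Vec dy) :
    (1 / γ - L2) * ‖θ - θ'‖ ≤ ‖Q.proxGrad γ z θ - Q.proxGrad γ z θ'‖ := by
  have e : Q.proxGrad γ z θ - Q.proxGrad γ z θ' = (1 / γ) • (θ - θ')
      - ((∇ Q.G (pair z.fst θ')).snd - (∇ Q.G (pair z.fst θ)).snd) := by
    simp only [proxGrad, smul_sub]; abel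
  have h1 : ‖(∇ Q.G (pair z.fst θ')).snd - (∇ Q.G (pair z.fst θ)).snd‖ ≤ L2 * ‖θ - θ'‖ := by
    rw [← WithLp.sub_snd]
    refine (norm_snd_le _).trans ?_
    have := h.lipschitz.dist_le_mul (pair z.fst θ') (pair z.fst θ)
    rw [dist_eq_norm, dist_eq_norm] at this
    refine this.trans_eq ?_
    congr 1
    have e2 : pair z.fst θ' - pair z.fst θ = pair 0 (θ' - θ) :=
      pair_ext (by simp) (by simp)
    rw [e2, norm_sub_rev θ, ← sq_eq_sq₀ (norm_nonneg _) (norm_nonneg _), norm_pair_sq]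
    simp
  rw [e]
  have h2 := norm_sub_norm_le ((1 / γ) • (θ - θ'))
    ((∇ Q.G (pair z.fst θ')).snd - (∇ Q.G (pair z.fst θ)).snd)
  have h3 : ‖(1 / γ) • (θ - θ')‖ = 1 / γ * ‖θ - θ'‖ := by
    have := h.pos
    rw [norm_smul, Real.norm_of_nonneg (by positivity)]
  linarith

theorem gap_mul_norm_sub_proxPoint_le (z : Pair dx dy) (θ : Vec dy) :
    (1 / γ - L2) * ‖θ - Q.proxPoint γ z‖ ≤ ‖Q.proxGrad γ z θ‖ := by
  simpa [h.proxGrad_proxPoint] using h.gap_mul_norm_sub_le z θ (Q.proxPoint γ z)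

theorem norm_proxPoint_add_sub_le (z u : Pair dx dy) :
    ‖Q.proxPoint γ (z + u) - Q.proxPoint γ z‖ ≤ (L2 + 1 / γ) / (1 / γ - L2) * ‖u‖ := by
  rw [div_mul_eq_mul_div, le_div_iff₀ h.gap_pos, mul_comm]
  refine (h.gap_mul_norm_sub_proxPoint_le z _).trans ?_
  set θ := Q.proxPoint γ (z + u)
  have e : Q.proxGrad γ z θ = (∇ Q.G (pair z.fst θ) - ∇ Q.G (pair (z + u).fst θ)).snd
      + (1 / γ) • u.snd := by
    have e0 : Q.proxGrad γ z θ = Q.proxGrad γ z θ - Q.proxGrad γ (z + u) θ := by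
      rw [h.proxGrad_proxPoint, sub_zero]
    rw [e0]
    simp only [proxGrad, smul_sub, WithLp.sub_snd, WithLp.add_snd, smul_add]; abel
  have h1 : ‖∇ Q.G (pair z.fst θ) - ∇ Q.G (pair (z + u).fst θ)‖ ≤ L2 * ‖u‖ := by
    have := h.lipschitz.dist_le_mul (pair z.fst θ) (pair (z + u).fst θ)
    rw [dist_eq_norm, dist_eq_norm] at this
    refine this.trans ?_
    gcongr
    have e2 : pair z.fst θ - pair (z + u).fst θ = pair (-u.fst) 0 :=
      pair_ext (by simp) (by simp)
    refine le_trans (le_of_eq ?_) (norm_fst_le u)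
    rw [e2, ← sq_eq_sq₀ (norm_nonneg _) (norm_nonneg _), norm_pair_sq]
    simp
  rw [e, add_mul]
  refine (norm_add_le _ _).trans (add_le_add ((norm_snd_le _).trans h1) ?_)
  have := h.pos
  rw [norm_smul, Real.norm_of_nonneg (by positivity)]
  gcongr
  exact norm_snd_le u

theorem continuous_proxPoint : Continuous (Q.proxPoint γ) := by
  have hK : 0 ≤ (L2 + 1 / γ) / (1 / γ - L2) := by
    have := h.gap_pos; have := h.pos; positivity
  refine LipschitzWith.continuous (K := ⟨_, hK⟩) (LipschitzWith.of_dist_le_mul fun z w => ?_)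
  have := h.norm_proxPoint_add_sub_le w (z - w)
  rwa [add_sub_cancel, ← dist_eq_norm, ← dist_eq_norm] at this

theorem abs_moreau_expansion_le (z u : Pair dx dy) :
    |Q.moreau γ (z + u) - Q.moreau γ z - inner ℝ (Q.envGrad γ z (Q.proxPoint γ z)) u|
      ≤ (L2 + 1 / γ) * (1 + ((L2 + 1 / γ) / (1 / γ - L2)) ^ 2) * ‖u‖ ^ 2 := by
  set κ := (L2 + 1 / γ) / (1 / γ - L2)
  have hM : 0 < L2 + 1 / γ := by have := h.pos; positivity
  set M : ℝ := L2 + 1 / γ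
  have hu := (abs_le.1 (abs_proxObjective_expansion_le h.differentiable h.lipschitz h.pos z u
    (Q.proxPoint γ z) 0)).2
  have hl := (abs_le.1 (abs_proxObjective_expansion_le h.differentiable h.lipschitz h.pos z u
    (Q.proxPoint γ z) (Q.proxPoint γ (z + u) - Q.proxPoint γ z))).1
  rw [h.proxGrad_proxPoint, inner_zero_left, add_sub_cancel, ← h.moreau_eq, ← h.moreau_eq] at hl
  rw [inner_zero_right, add_zero, ← h.moreau_eq, norm_zero] at hu
  have hV := h.moreau_le (z + u) (Q.proxPoint γ z)
  have hw : M * ‖Q.proxPoint γ (z + u) - Q.proxPoint γ z‖ ^ 2 ≤ M * (κ ^ 2 * ‖u‖ ^ 2) := by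
    rw [← mul_pow]; gcongr; exact h.norm_proxPoint_add_sub_le z u
  have hp : 0 ≤ M * (κ ^ 2 * ‖u‖ ^ 2) := by positivity
  refine abs_le.2 ⟨?_, ?_⟩ <;> nlinarith

theorem hasGradientAt_moreau (z : Pair dx dy) :
    HasGradientAt (Q.moreau γ) (Q.envGrad γ z (Q.proxPoint γ z)) z :=
  hasGradientAt_of_abs_expansion_le (h.abs_moreau_expansion_le z)

theorem norm_envGrad_sub_sq_le (z : Pair dx dy) (θ θ' : Vec dy) :
    ‖Q.envGrad γ z θ - Q.envGrad γ z θ'‖ ^ 2 ≤ (L2 ^ 2 + 1 / γ ^ 2) * ‖θ - θ'‖ ^ 2 := by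
  have e : Q.envGrad γ z θ - Q.envGrad γ z θ'
      = pair (∇ Q.G (pair z.fst θ) - ∇ Q.G (pair z.fst θ')).fst ((1 / γ) • (θ' - θ)) :=
    pair_ext (by simp [envGrad]) (by simp [envGrad, ← smul_sub])
  have h1 : ‖∇ Q.G (pair z.fst θ) - ∇ Q.G (pair z.fst θ')‖ ≤ L2 * ‖θ - θ'‖ := by
    have := h.lipschitz.dist_le_mul (pair z.fst θ) (pair z.fst θ')
    rw [dist_eq_norm, dist_eq_norm] at this
    refine this.trans_eq ?_
    congr 1
    have e2 : pair z.fst θ - pair z.fst θ' = pair 0 (θ - θ') :=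
      pair_ext (by simp) (by simp)
    rw [e2, ← sq_eq_sq₀ (norm_nonneg _) (norm_nonneg _), norm_pair_sq]
    simp
  rw [e, norm_pair_sq, add_mul]
  refine add_le_add ?_ (le_of_eq ?_)
  · rw [← mul_pow]; gcongr; exact (norm_fst_le _).trans h1
  · have := h.pos
    rw [norm_smul, Real.norm_of_nonneg (by positivity), norm_sub_rev, mul_pow]
    congr 1
    rw [div_pow, one_pow]

theorem proxObjective_sub_moreau_le (z : Pair dx dy) (θ : Vec dy) :
    Q.proxObjective γ z θ - Q.moreau γ z ≤ (L2 + 1 / γ) * ‖θ - Q.proxPoint γ z‖ ^ 2 := by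
  have hu := (abs_le.1 (abs_proxObjective_expansion_le h.differentiable h.lipschitz h.pos z 0
    (Q.proxPoint γ z) (θ - Q.proxPoint γ z))).2
  rw [h.proxGrad_proxPoint, inner_zero_left, inner_zero_right, add_zero, add_sub_cancel,
    ← h.moreau_eq, norm_zero] at hu
  linarith

end IsProxRegular

end Problem

section Connectivity

variable {n : ℕ} {W : Matrix (Fin n) (Fin n) ℝ}

theorem connectivity_nonneg (hW : W.IsHermitian) : 0 ≤ connectivity W hW := by
  unfold connectivity
  split_ifs
  · exact le_max_of_le_left (abs_nonneg _)
  · exact le_rfl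

theorem abs_eigenvalues₀_le_connectivity (hW : W.IsHermitian) (i : Fin (Fintype.card (Fin n)))
    (hi : 1 ≤ (i : ℕ)) : |hW.eigenvalues₀ i| ≤ connectivity W hW := by
  have hin : (i : ℕ) < n := by simpa using i.2
  have h : 2 ≤ n := by omega
  rw [connectivity, dif_pos h]
  have h1 : hW.eigenvalues₀ i ≤ hW.eigenvalues₀ ⟨1, by rw [Fintype.card_fin]; omega⟩ :=
    hW.eigenvalues₀_antitone (Fin.le_def.2 hi)
  have h2 : hW.eigenvalues₀ ⟨n - 1, by rw [Fintype.card_fin]; omega⟩ ≤ hW.eigenvalues₀ i :=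
    hW.eigenvalues₀_antitone (Fin.le_def.2 (by simp; omega))
  exact abs_le_max_abs_abs h2 h1 |>.trans (max_comm _ _).le

theorem IsWeightMatrix.sum_row (hW : IsWeightMatrix W) (i : Fin n) : ∑ j, W i j = 1 :=
  sum_row_of_mem_doublyStochastic hW.doublyStochastic i

theorem IsWeightMatrix.sum_col (hW : IsWeightMatrix W) (j : Fin n) : ∑ i, W i j = 1 :=
  sum_col_of_mem_doublyStochastic hW.doublyStochastic j

/-- On vectors with zero sum, a weight matrix contracts by its connectivity parameter. -/
theorem IsWeightMatrix.sum_mulVec_sq_le (hW : IsWeightMatrix W)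
    (hρ : connectivity W hW.isHermitian < 1) (v : Fin n → ℝ) (hv : ∑ i, v i = 0) :
    ∑ i, (∑ j, W i j * v j) ^ 2 ≤ connectivity W hW.isHermitian ^ 2 * ∑ i, v i ^ 2 := by
  set H := hW.isHermitian
  set ρ := connectivity W H
  set b := H.eigenvectorBasis
  set e : Fin (Fintype.card (Fin n)) ≃ Fin n := Fintype.equivOfCardEq (Fintype.card_fin _)
  have hsymm : ∀ i (u : EuclideanSpace ℝ (Fin n)),
      inner ℝ (b i) (WithLp.toLp 2 (W.mulVec u)) = H.eigenvalues i * inner ℝ (b i) u := by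
    intro i u
    have h1 : inner ℝ (b i) (WithLp.toLp 2 (W.mulVec u))
        = (b i).ofLp ⬝ᵥ W.mulVec u.ofLp := by
      simp [PiLp.inner_apply, dotProduct, mul_comm]
    have hT : W.transpose = W := by simpa [Matrix.IsHermitian] using H
    rw [h1, Matrix.dotProduct_mulVec, ← Matrix.mulVec_transpose, hT, H.mulVec_eigenvectorBasis]
    simp [PiLp.inner_apply, dotProduct, mul_comm, Finset.mul_sum, mul_left_comm, b]
  have hone : ∀ i, H.eigenvalues i ≠ 1 → inner ℝ (b i) (WithLp.toLp 2 (1 : Fin n → ℝ)) = 0 := by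
    intro i hi
    have h1 := hsymm i (WithLp.toLp 2 1)
    have h2 : W.mulVec (1 : Fin n → ℝ) = 1 := mulVec_one_of_mem_doublyStochastic hW.doublyStochastic
    simp only [h2] at h1
    have : (H.eigenvalues i - 1) * inner ℝ (b i) (WithLp.toLp 2 (1 : Fin n → ℝ)) = 0 := by
      rw [sub_mul, ← h1, one_mul, sub_self]
    exact (mul_eq_zero.1 this).resolve_left (sub_ne_zero.2 hi)
  have hvone : inner ℝ (WithLp.toLp 2 (1 : Fin n → ℝ)) (WithLp.toLp 2 v) = (0 : ℝ) := by
    simpa [PiLp.inner_apply] using hv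
  have hterm : ∀ i, (H.eigenvalues i * inner ℝ (b i) (WithLp.toLp 2 v)) ^ 2
      ≤ ρ ^ 2 * (inner ℝ (b i) (WithLp.toLp 2 v)) ^ 2 := by
    intro i
    rw [mul_pow]
    rcases Nat.eq_zero_or_pos (e.symm i : ℕ) with h0 | h0
    · have hother : ∀ j, j ≠ i → inner ℝ (b j) (WithLp.toLp 2 (1 : Fin n → ℝ)) = 0 := by
        intro j hj
        refine hone j fun hj1 => ?_
        have hj0 : 1 ≤ (e.symm j : ℕ) := by
          by_contra hc
          refine hj (e.symm.injective (Fin.ext ?_))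
          omega
        have h1 := abs_eigenvalues₀_le_connectivity H (e.symm j) hj0
        have h2 : H.eigenvalues₀ (e.symm j) = 1 := hj1
        rw [h2, abs_one] at h1
        exact absurd hρ (not_lt.2 h1)
      have hsum := b.sum_inner_mul_inner (WithLp.toLp 2 (1 : Fin n → ℝ)) (WithLp.toLp 2 v)
      have hnorm := b.sum_inner_mul_inner (WithLp.toLp 2 (1 : Fin n → ℝ)) (WithLp.toLp 2 1)
      rw [hvone, Finset.sum_eq_single i (fun j _ hj => by
        rw [real_inner_comm, hother j hj, zero_mul]) (by simp)] at hsum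
      rw [Finset.sum_eq_single i (fun j _ hj => by
        rw [real_inner_comm, hother j hj, zero_mul]) (by simp)] at hnorm
      have hn : inner ℝ (WithLp.toLp 2 (1 : Fin n → ℝ)) (WithLp.toLp 2 1) = (n : ℝ) := by
        simp [EuclideanSpace.norm_sq_eq]
      have hn0 : (n : ℝ) ≠ 0 := Nat.cast_ne_zero.2 (Nat.ne_of_gt (Fin.pos i))
      have : inner ℝ (b i) (WithLp.toLp 2 v) = (0 : ℝ) := by
        refine (mul_eq_zero.1 hsum).resolve_left fun hc => hn0 ?_
        rw [← hn, ← hnorm, hc, zero_mul]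
      rw [this]; simp
    · have h1 : |H.eigenvalues i| ≤ ρ := abs_eigenvalues₀_le_connectivity H (e.symm i) h0
      have h2 : H.eigenvalues i ^ 2 ≤ ρ ^ 2 := by
        rw [← sq_abs]; gcongr
      gcongr
  have hL : ∑ i, (∑ j, W i j * v j) ^ 2 = ‖WithLp.toLp 2 (W.mulVec v)‖ ^ 2 := by
    rw [EuclideanSpace.norm_sq_eq]
    simp [Matrix.mulVec, dotProduct]
  have hR : ∑ i, v i ^ 2 = ‖WithLp.toLp 2 v‖ ^ 2 := by
    rw [EuclideanSpace.norm_sq_eq]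
    simp
  rw [hL, hR, ← b.sum_sq_norm_inner_right, ← b.sum_sq_norm_inner_right, Finset.mul_sum]
  refine Finset.sum_le_sum fun i _ => ?_
  rw [hsymm i (WithLp.toLp 2 v), Real.norm_eq_abs, Real.norm_eq_abs, sq_abs, sq_abs]
  exact hterm i

theorem IsWeightMatrix.sum_norm_sq_le (hW : IsWeightMatrix W)
    (hρ : connectivity W hW.isHermitian < 1) {d : ℕ} (v : Fin n → Vec d) (hv : ∑ i, v i = 0) :
    ∑ i, ‖∑ j, W i j • v j‖ ^ 2 ≤ connectivity W hW.isHermitian ^ 2 * ∑ i, ‖v i‖ ^ 2 := by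
  have e : ∀ u : Fin n → Vec d, ∑ i, ‖u i‖ ^ 2 = ∑ l, ∑ i, (u i l) ^ 2 := fun u => by
    rw [Finset.sum_comm]
    refine Finset.sum_congr rfl fun i _ => ?_
    rw [EuclideanSpace.norm_sq_eq]; simp
  rw [e, e, Finset.mul_sum]
  refine Finset.sum_le_sum fun l _ => ?_
  have h0 : ∑ i, v i l = 0 := by
    have := congrArg (fun w : Vec d => w l) hv
    simpa using this
  simpa using hW.sum_mulVec_sq_le hρ (fun i => v i l) h0

theorem IsWeightMatrix.avg_sum_smul (hW : IsWeightMatrix W) {E : Type*} [NormedAddCommGroup E]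
    [InnerProductSpace ℝ E] (v : Fin n → E) : (avg fun i => ∑ j, W i j • v j) = avg v := by
  unfold avg
  rw [Finset.sum_comm]
  simp only [← Finset.sum_smul, hW.sum_col, one_smul]

/-- One gossip round after a step of length `l` along `d`: the consensus error contracts. -/
theorem IsWeightMatrix.avg_norm_sub_avg_sq_le (hW : IsWeightMatrix W)
    (hρ : connectivity W hW.isHermitian < 1) {m : ℕ} (v d : Fin n → Vec m) (c : Vec m) (l : ℝ) :
    (avg fun i => ‖(∑ j, W i j • (v j - l • d j)) - avg fun i => ∑ j, W i j • (v j - l • d j)‖ ^ 2)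
      ≤ connectivity W hW.isHermitian * (avg fun i => ‖v i - avg v‖ ^ 2)
        + 2 / (1 - connectivity W hW.isHermitian) * l ^ 2 * avg fun i => ‖d i - c‖ ^ 2 := by
  rcases Nat.eq_zero_or_pos n with rfl | hn
  · simp [avg]
  have hn' : (n : ℝ) ≠ 0 := by positivity
  have hρ0 := connectivity_nonneg hW.isHermitian
  set ρ := connectivity W hW.isHermitian
  have hρ1 : 0 < 1 - ρ := sub_pos.2 hρ
  rw [hW.avg_sum_smul]
  set w : Fin n → Vec m := fun j => (v j - avg v) - l • (d j - avg d) with hw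
  have hwsum : ∑ j, w j = 0 := by
    have h0 : ∀ u : Fin n → Vec m, ∑ j, (u j - avg u) = 0 := fun u => by
      simp [avg, ← Nat.cast_smul_eq_nsmul ℝ, smul_smul, hn']
    simp only [hw, Finset.sum_sub_distrib (f := fun j => v j - avg v), ← Finset.smul_sum, h0]
    simp
  have e : ∀ i, (∑ j, W i j • (v j - l • d j)) - (avg fun j => v j - l • d j)
      = ∑ j, W i j • w j := by
    intro i
    have h1 : ∀ j, W i j • w j = W i j • (v j - l • d j)
        - W i j • (avg fun j => v j - l • d j) := fun j => by
      rw [avg_sub, avg_smul, ← smul_sub, hw]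
      congr 1
      simp only [smul_sub]; abel
    simp only [h1]
    rw [Finset.sum_sub_distrib, ← Finset.sum_smul, hW.sum_row, one_smul]
  simp only [e]
  have hc : ρ ^ 2 * ((1 + (1 - ρ))) ≤ ρ := by nlinarith [mul_nonneg hρ0 (sq_nonneg (1 - ρ))]
  have hc' : ρ ^ 2 * (1 + 1 / (1 - ρ)) ≤ 2 / (1 - ρ) := by
    rw [show 1 + 1 / (1 - ρ) = (2 - ρ) / (1 - ρ) by field_simp; ring, ← mul_div_assoc]
    gcongr
    nlinarith [mul_nonneg hρ0 (sq_nonneg (1 - ρ))]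
  have hy : ∀ j, ‖w j‖ ^ 2 ≤ (1 + (1 - ρ)) * ‖v j - avg v‖ ^ 2
      + (1 + 1 / (1 - ρ)) * (l ^ 2 * ‖d j - avg d‖ ^ 2) := by
    intro j
    have h1 : ‖w j‖ ≤ ‖v j - avg v‖ + |l| * ‖d j - avg d‖ := by
      refine (norm_sub_le _ _).trans_eq ?_
      rw [norm_smul, Real.norm_eq_abs]
    set p := ‖v j - avg v‖
    set q := ‖d j - avg d‖
    have h2 : ‖w j‖ ^ 2 ≤ (p + |l| * q) ^ 2 := by gcongr
    have h3 : 2 * p * (|l| * q) ≤ (1 - ρ) * p ^ 2 + 1 / (1 - ρ) * (|l| * q) ^ 2 := by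
      have : 0 ≤ 1 / (1 - ρ) * ((1 - ρ) * p - |l| * q) ^ 2 := by positivity
      have e2 : 1 / (1 - ρ) * ((1 - ρ) * p - |l| * q) ^ 2
        = (1 - ρ) * p ^ 2 - 2 * p * (|l| * q) + 1 / (1 - ρ) * (|l| * q) ^ 2 := by
        field_simp; ring
      linarith
    have h4 : (|l| * q) ^ 2 = l ^ 2 * q ^ 2 := by rw [mul_pow, sq_abs]
    rw [h4] at h3
    nlinarith
  have hmain : (avg fun i => ‖∑ j, W i j • w j‖ ^ 2) ≤ ρ ^ 2 * avg fun i => ‖w i‖ ^ 2 := by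
    unfold avg
    simp only [smul_eq_mul]
    rw [mul_left_comm]
    gcongr
    exact hW.sum_norm_sq_le hρ w hwsum
  have hyavg : (avg fun i => ‖w i‖ ^ 2) ≤ (1 + (1 - ρ)) * (avg fun i => ‖v i - avg v‖ ^ 2)
      + (1 + 1 / (1 - ρ)) * (l ^ 2 * avg fun i => ‖d i - avg d‖ ^ 2) := by
    refine (avg_mono hy).trans_eq ?_
    rw [avg_add]
    simp only [← smul_eq_mul, avg_smul]
  have hd := DSBO.avg_norm_sub_avg_sq_le d c
  have hA : 0 ≤ avg fun i => ‖v i - avg v‖ ^ 2 := avg_nonneg fun _ => by positivity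
  have hB : 0 ≤ avg fun i => ‖d i - avg d‖ ^ 2 := avg_nonneg fun _ => by positivity
  calc _ ≤ ρ ^ 2 * ((1 + (1 - ρ)) * (avg fun i => ‖v i - avg v‖ ^ 2)
      + (1 + 1 / (1 - ρ)) * (l ^ 2 * avg fun i => ‖d i - avg d‖ ^ 2)) := by
        refine hmain.trans ?_; gcongr
    _ = ρ ^ 2 * (1 + (1 - ρ)) * (avg fun i => ‖v i - avg v‖ ^ 2)
      + ρ ^ 2 * (1 + 1 / (1 - ρ)) * (l ^ 2 * avg fun i => ‖d i - avg d‖ ^ 2) := by ring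
    _ ≤ ρ * (avg fun i => ‖v i - avg v‖ ^ 2)
      + 2 / (1 - ρ) * (l ^ 2 * avg fun i => ‖d i - c‖ ^ 2) := by gcongr
    _ = _ := by ring

end Connectivity

section Inequalities

variable {E : Type*} [NormedAddCommGroup E]

theorem norm_add_sq_le_two (a b : E) : ‖a + b‖ ^ 2 ≤ 2 * (‖a‖ ^ 2 + ‖b‖ ^ 2) := by
  have h1 : ‖a + b‖ ^ 2 ≤ (‖a‖ + ‖b‖) ^ 2 := by gcongr; exact norm_add_le _ _
  nlinarith [sq_nonneg (‖a‖ - ‖b‖)]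

theorem norm_add_sq_le_three (a b c : E) :
    ‖a + b + c‖ ^ 2 ≤ 3 * (‖a‖ ^ 2 + ‖b‖ ^ 2 + ‖c‖ ^ 2) := by
  have h1 : ‖a + b + c‖ ^ 2 ≤ (‖a‖ + ‖b‖ + ‖c‖) ^ 2 := by gcongr; exact norm_add₃_le
  nlinarith [sq_nonneg (‖a‖ - ‖b‖), sq_nonneg (‖a‖ - ‖c‖), sq_nonneg (‖b‖ - ‖c‖)]

theorem norm_add_sq_le_four (a b c d : E) :
    ‖a + b + c + d‖ ^ 2 ≤ 4 * (‖a‖ ^ 2 + ‖b‖ ^ 2 + ‖c‖ ^ 2 + ‖d‖ ^ 2) := by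
  have h1 : ‖a + b + c + d‖ ^ 2 ≤ (‖a‖ + ‖b‖ + ‖c‖ + ‖d‖) ^ 2 := by gcongr; exact norm_add₄_le
  nlinarith [sq_nonneg (‖a‖ - ‖b‖), sq_nonneg (‖a‖ - ‖c‖), sq_nonneg (‖b‖ - ‖c‖),
    sq_nonneg (‖a‖ - ‖d‖), sq_nonneg (‖b‖ - ‖d‖), sq_nonneg (‖c‖ - ‖d‖)]

/-- Descent along a perturbed pair of directions: `q - r` is the ideal direction of the upper
variable and `g` that of the lower one, `e`, `e'` are biases and `N`, `N'` are noises. -/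
theorem perturbed_descent_le [InnerProductSpace ℝ E] {E' : Type*} [NormedAddCommGroup E'] [InnerProductSpace ℝ E']
    {q r e N : E} {g e' N' : E'} {l c κ M : ℝ} (hl : 0 < l) (hc : 0 < c) (hM : 0 ≤ M)
    (hr : ‖r‖ ^ 2 ≤ κ * ‖g‖ ^ 2) (hκ : c * κ ≤ 1 / 16) (h1 : 16 * M * (c * l) ≤ 1)
    (h2 : 12 * M * l ≤ 1) :
    inner ℝ (q + r) (-(c * l) • (q - r + e + N)) + inner ℝ g (-l • (g + e' + N'))
      + M * (‖-(c * l) • (q - r + e + N)‖ ^ 2 + ‖-l • (g + e' + N')‖ ^ 2)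
      ≤ -(c * l / 4) * ‖q‖ ^ 2 + 2 * l * (c * ‖e‖ ^ 2 + ‖e'‖ ^ 2)
        - c * l * inner ℝ (q + r) N - l * inner ℝ g N'
        + 4 * M * l ^ 2 * (c ^ 2 * ‖N‖ ^ 2 + ‖N'‖ ^ 2) := by
  have hcl : 0 < c * l := mul_pos hc hl
  have a1 : inner ℝ (q + r) (q - r + e + N)
      = ‖q‖ ^ 2 - ‖r‖ ^ 2 + inner ℝ (q + r) e + inner ℝ (q + r) N := by
    rw [inner_add_right, inner_add_right, inner_sub_right, inner_add_left, inner_add_left,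
      real_inner_self_eq_norm_sq, real_inner_self_eq_norm_sq, real_inner_comm q r]
    ring
  have a2 : inner ℝ g (g + e' + N') = ‖g‖ ^ 2 + inner ℝ g e' + inner ℝ g N' := by
    rw [inner_add_right, inner_add_right, real_inner_self_eq_norm_sq]
  have b1 : -inner ℝ (q + r) e ≤ (‖q‖ ^ 2 + ‖r‖ ^ 2) / 2 + ‖e‖ ^ 2 := by
    have := (abs_le.1 (abs_real_inner_le_norm (q + r) e)).1
    have h3 := norm_add_sq_le_two q r
    nlinarith [sq_nonneg (‖q + r‖ - 2 * ‖e‖)]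
  have b2 : -inner ℝ g e' ≤ ‖g‖ ^ 2 / 4 + ‖e'‖ ^ 2 := by
    have := (abs_le.1 (abs_real_inner_le_norm g e')).1
    nlinarith [sq_nonneg (‖g‖ - 2 * ‖e'‖)]
  have c1 : ‖q - r + e + N‖ ^ 2 ≤ 4 * (‖q‖ ^ 2 + ‖r‖ ^ 2 + ‖e‖ ^ 2 + ‖N‖ ^ 2) := by
    have := norm_add_sq_le_four q (-r) e N
    rwa [norm_neg, ← sub_eq_add_neg] at this
  have c2 := norm_add_sq_le_three g e' N'
  rw [real_inner_smul_right, real_inner_smul_right, norm_smul, norm_smul, mul_pow, mul_pow, a1, a2,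
    Real.norm_eq_abs, Real.norm_eq_abs, sq_abs, sq_abs]
  have d1 : M * ((-(c * l)) ^ 2 * ‖q - r + e + N‖ ^ 2)
      ≤ c * l / 4 * (‖q‖ ^ 2 + ‖r‖ ^ 2 + ‖e‖ ^ 2) + 4 * M * l ^ 2 * (c ^ 2 * ‖N‖ ^ 2) := by
    have t1 : M * ((-(c * l)) ^ 2 * ‖q - r + e + N‖ ^ 2)
        ≤ M * ((-(c * l)) ^ 2 * (4 * (‖q‖ ^ 2 + ‖r‖ ^ 2 + ‖e‖ ^ 2 + ‖N‖ ^ 2))) := by gcongr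
    have t2 : 16 * M * (c * l) * (c * l / 4 * (‖q‖ ^ 2 + ‖r‖ ^ 2 + ‖e‖ ^ 2))
        ≤ 1 * (c * l / 4 * (‖q‖ ^ 2 + ‖r‖ ^ 2 + ‖e‖ ^ 2)) := by gcongr
    linarith
  have d2 : M * ((-l) ^ 2 * ‖g + e' + N'‖ ^ 2)
      ≤ l / 4 * (‖g‖ ^ 2 + ‖e'‖ ^ 2) + 4 * M * l ^ 2 * ‖N'‖ ^ 2 := by
    have t1 : M * ((-l) ^ 2 * ‖g + e' + N'‖ ^ 2)
        ≤ M * ((-l) ^ 2 * (3 * (‖g‖ ^ 2 + ‖e'‖ ^ 2 + ‖N'‖ ^ 2))) := by gcongr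
    have t2 : 12 * M * l * (l / 4 * (‖g‖ ^ 2 + ‖e'‖ ^ 2)) ≤ 1 * (l / 4 * (‖g‖ ^ 2 + ‖e'‖ ^ 2)) := by
      gcongr
    have t3 : 0 ≤ M * l ^ 2 * ‖N'‖ ^ 2 := by positivity
    linarith
  have f1 := mul_le_mul_of_nonneg_left b1 hcl.le
  have f2 := mul_le_mul_of_nonneg_left b2 hl.le
  have f3 : c * l * ‖r‖ ^ 2 ≤ l / 16 * ‖g‖ ^ 2 := by
    calc _ ≤ c * l * (κ * ‖g‖ ^ 2) := by gcongr
      _ = c * κ * (l * ‖g‖ ^ 2) := by ring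
      _ ≤ 1 / 16 * (l * ‖g‖ ^ 2) := by gcongr
      _ = _ := by ring
  have p1 : 0 ≤ c * l * ‖e‖ ^ 2 := by positivity
  have p2 : 0 ≤ l * ‖e'‖ ^ 2 := by positivity
  have p3 : 0 ≤ l * ‖g‖ ^ 2 := by positivity
  have p4 : 0 ≤ c * l * ‖q‖ ^ 2 := by positivity
  linarith

end Inequalities

section AvgPair

variable {n dx dy : ℕ}

theorem avg_fst (v : Fin n → Pair dx dy) : (avg fun i => (v i).fst) = (avg v).fst := by
  have := map_sum (WithLp.fstL 2 ℝ (Vec dx) (Vec dy)) v Finset.univ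
  simp only [avg, WithLp.smul_fst]
  congr 1
  exact this.symm

theorem avg_snd (v : Fin n → Pair dx dy) : (avg fun i => (v i).snd) = (avg v).snd := by
  have := map_sum (WithLp.sndL 2 ℝ (Vec dx) (Vec dy)) v Finset.univ
  simp only [avg, WithLp.smul_snd]
  congr 1
  exact this.symm

/-- The point `(x̄, θ̄)`. -/
def State.lowerMean (s : State n dx dy) : Pair dx dy := pair (avg s.x) (avg s.θ)

/-- The projection `(x, y) ↦ (x, 0)`. -/
def dropSnd (v : Pair dx dy) : Pair dx dy := pair v.fst 0

theorem norm_dropSnd_le (v : Pair dx dy) : ‖dropSnd v‖ ≤ ‖v‖ := by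
  refine le_trans (le_of_eq ?_) (norm_fst_le v)
  rw [← sq_eq_sq₀ (norm_nonneg _) (norm_nonneg _), dropSnd, norm_pair_sq]
  simp

theorem State.consensusError_nonneg (s : State n dx dy) : 0 ≤ s.consensusError :=
  avg_nonneg fun _ => by positivity

theorem State.avg_norm_sub_mean_sq_le (s : State n dx dy) :
    (avg fun i => ‖pair (s.x i) (s.y i) - s.mean‖ ^ 2) ≤ s.consensusError :=
  avg_mono fun i => by
    have e : pair (s.x i) (s.y i) - s.mean = pair (s.x i - avg s.x) (s.y i - avg s.y) := rfl
    rw [e, norm_pair_sq]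
    have := sq_nonneg ‖s.θ i - avg s.θ‖
    linarith

theorem State.avg_norm_sub_lowerMean_sq_le (s : State n dx dy) :
    (avg fun i => ‖pair (s.x i) (s.θ i) - s.lowerMean‖ ^ 2) ≤ s.consensusError :=
  avg_mono fun i => by
    have e : pair (s.x i) (s.θ i) - s.lowerMean = pair (s.x i - avg s.x) (s.θ i - avg s.θ) := rfl
    rw [e, norm_pair_sq]
    have := sq_nonneg ‖s.y i - avg s.y‖
    linarith

end AvgPair

namespace Problem

variable {n dx dy : ℕ} {Ξf Ξg : Type*} [MeasurableSpace Ξf] [MeasurableSpace Ξg]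
variable (Q : Problem n dx dy Ξf Ξg)

/-- The error of the sample gradient of `f_i` at `(x_i, y_i)`. -/
def errF (s : State n dx dy) (ξ : Fin n → Ξf) (i : Fin n) : Pair dx dy :=
  Q.gradF i (pair (s.x i) (s.y i)) (ξ i) - ∇ (Q.f i) (pair (s.x i) (s.y i))

/-- The error of the sample gradient of `g_i` at `(x_i, y_i)`. -/
def errG (s : State n dx dy) (ξ : Fin n → Ξg) (i : Fin n) : Pair dx dy :=
  Q.gradG i (pair (s.x i) (s.y i)) (ξ i) - ∇ (Q.g i) (pair (s.x i) (s.y i))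

/-- The error of the sample gradient of `g_i` at `(x_i, θ_i)`. -/
def errH (s : State n dx dy) (ξ : Fin n → Ξg) (i : Fin n) : Pair dx dy :=
  Q.gradG i (pair (s.x i) (s.θ i)) (ξ i) - ∇ (Q.g i) (pair (s.x i) (s.θ i))

/-- `avg ∇f_i(x_i, y_i) - ∇F(x̄, ȳ)`. -/
def biasF (s : State n dx dy) : Pair dx dy :=
  (avg fun i => ∇ (Q.f i) (pair (s.x i) (s.y i))) - ∇ Q.F s.mean

/-- `avg ∇g_i(x_i, y_i) - ∇G(x̄, ȳ)`. -/
def biasG (s : State n dx dy) : Pair dx dy :=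
  (avg fun i => ∇ (Q.g i) (pair (s.x i) (s.y i))) - ∇ Q.G s.mean

/-- `avg ∇g_i(x_i, θ_i) - ∇G(x̄, θ̄)`. -/
def biasH (s : State n dx dy) : Pair dx dy :=
  (avg fun i => ∇ (Q.g i) (pair (s.x i) (s.θ i))) - ∇ Q.G s.lowerMean

/-- The gradient of `Psi`. -/
def gradPsi (γ μ : ℝ) (z : Pair dx dy) : Pair dx dy :=
  μ • ∇ Q.F z + ∇ Q.G z - Q.envGrad γ z (Q.proxPoint γ z)

/-- The smooth potential `μ (F - Flow) + (G - V_γ) + (h - V_γ)`. -/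
def potential (γ μ Flow : ℝ) (z : Pair dx dy) (θ : Vec dy) : ℝ :=
  μ * (Q.F z - Flow) + (Q.G z - Q.moreau γ z) + (Q.proxObjective γ z θ - Q.moreau γ z)

variable {Q} {L1 L2 : ℝ≥0} {γ μ : ℝ}

theorem IsSmooth.norm_biasF_sq_le (h : Q.IsSmooth L1 L2) (s : State n dx dy) :
    ‖Q.biasF s‖ ^ 2 ≤ L1 ^ 2 * s.consensusError := by
  rw [biasF, (h.hasGradientAt_F _).gradient]
  refine (norm_avg_sub_avg_sq_le_of_lipschitz h.lipschitz_f _ fun _ => s.mean).trans ?_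
  gcongr
  exact s.avg_norm_sub_mean_sq_le

theorem IsSmooth.norm_biasG_sq_le (h : Q.IsSmooth L1 L2) (s : State n dx dy) :
    ‖Q.biasG s‖ ^ 2 ≤ L2 ^ 2 * s.consensusError := by
  rw [biasG, (h.hasGradientAt_G _).gradient]
  refine (norm_avg_sub_avg_sq_le_of_lipschitz h.lipschitz_g _ fun _ => s.mean).trans ?_
  gcongr
  exact s.avg_norm_sub_mean_sq_le

theorem IsSmooth.norm_biasH_sq_le (h : Q.IsSmooth L1 L2) (s : State n dx dy) :
    ‖Q.biasH s‖ ^ 2 ≤ L2 ^ 2 * s.consensusError := by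
  rw [biasH, (h.hasGradientAt_G _).gradient]
  refine (norm_avg_sub_avg_sq_le_of_lipschitz h.lipschitz_g _ fun _ => s.lowerMean).trans ?_
  gcongr
  exact s.avg_norm_sub_lowerMean_sq_le

section Step

variable {W : Matrix (Fin n) (Fin n) ℝ}

theorem step_mean_eq (hW : IsWeightMatrix W) (s : State n dx dy) (lθ l : ℝ)
    (ξf : Fin n → Ξf) (ξg : Fin n → Ξg) :
    (Q.step γ μ s W lθ l l ξf ξg).mean = s.mean + -l •
      (Q.gradPsi γ μ s.mean
          - (Q.envGrad γ s.mean (avg s.θ) - Q.envGrad γ s.mean (Q.proxPoint γ s.mean))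
        + (μ • Q.biasF s + Q.biasG s - dropSnd (Q.biasH s))
        + (μ • avg (Q.errF s ξf) + avg (Q.errG s ξg) - dropSnd (avg (Q.errH s ξg)))) := by
  have eF : avg (Q.errF s ξf) = (avg fun i => Q.gradF i (pair (s.x i) (s.y i)) (ξf i))
      - avg fun i => ∇ (Q.f i) (pair (s.x i) (s.y i)) := avg_sub _ _
  have eG : avg (Q.errG s ξg) = (avg fun i => Q.gradG i (pair (s.x i) (s.y i)) (ξg i))
      - avg fun i => ∇ (Q.g i) (pair (s.x i) (s.y i)) := avg_sub _ _
  have eH : avg (Q.errH s ξg) = (avg fun i => Q.gradG i (pair (s.x i) (s.θ i)) (ξg i))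
      - avg fun i => ∇ (Q.g i) (pair (s.x i) (s.θ i)) := avg_sub _ _
  have ex : avg (Q.step γ μ s W lθ l l ξf ξg).x = avg s.x - l •
      (μ • (avg fun i => Q.gradF i (pair (s.x i) (s.y i)) (ξf i)).fst
        + (avg fun i => Q.gradG i (pair (s.x i) (s.y i)) (ξg i)).fst
        - (avg fun i => Q.gradG i (pair (s.x i) (s.θ i)) (ξg i)).fst) := by
    unfold step
    dsimp only
    rw [hW.avg_sum_smul, avg_sub, avg_smul]
    unfold dirx
    rw [avg_sub, avg_add, avg_smul, avg_fst, avg_fst, avg_fst]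
  have ey : avg (Q.step γ μ s W lθ l l ξf ξg).y = avg s.y - l •
      (μ • (avg fun i => Q.gradF i (pair (s.x i) (s.y i)) (ξf i)).snd
        + (avg fun i => Q.gradG i (pair (s.x i) (s.y i)) (ξg i)).snd
        - (1 / γ) • (avg s.y - avg s.θ)) := by
    unfold step
    dsimp only
    rw [hW.avg_sum_smul, avg_sub, avg_smul]
    unfold diry
    rw [avg_sub, avg_add, avg_smul, avg_smul, avg_sub, avg_snd, avg_snd]
  rw [eF, eG, eH, State.mean, ex, ey]
  simp only [gradPsi, biasF, biasG, biasH]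
  refine pair_ext ?_ ?_
  · simp only [pair_fst, WithLp.add_fst, WithLp.sub_fst, WithLp.smul_fst, dropSnd, envGrad,
      State.mean, State.lowerMean]
    module
  · simp only [pair_snd, WithLp.add_snd, WithLp.sub_snd, WithLp.smul_snd, dropSnd, envGrad,
      State.mean, State.lowerMean]
    module

theorem step_avg_θ_eq (hW : IsWeightMatrix W) (s : State n dx dy) (lθ lx ly : ℝ)
    (ξf : Fin n → Ξf) (ξg : Fin n → Ξg) :
    avg (Q.step γ μ s W lθ lx ly ξf ξg).θ = avg s.θ + -lθ •
      (Q.proxGrad γ s.mean (avg s.θ) + (Q.biasH s).snd + (avg (Q.errH s ξg)).snd) := by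
  have eH : avg (Q.errH s ξg) = (avg fun i => Q.gradG i (pair (s.x i) (s.θ i)) (ξg i))
      - avg fun i => ∇ (Q.g i) (pair (s.x i) (s.θ i)) := avg_sub _ _
  unfold step
  dsimp only
  rw [hW.avg_sum_smul, avg_sub, avg_smul]
  unfold dirθ
  rw [avg_add, avg_smul, avg_sub, avg_snd, eH]
  simp only [proxGrad, biasH, WithLp.sub_snd, State.mean, State.lowerMean, pair_fst, pair_snd]
  module

end Step

end Problem

section Constants

/-- A smoothness constant of the potential. -/
def smoothConst (L1 L2 : ℝ≥0) (γ μ0 : ℝ) : ℝ :=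
  μ0 * L1 + L2 + (L2 + 1 / γ)
    + 2 * ((L2 + 1 / γ) * (1 + ((L2 + 1 / γ) / (1 / γ - L2)) ^ 2))

/-- The influence of the consensus error on the descent of the potential. -/
def biasConst (L1 L2 : ℝ≥0) (μ0 c : ℝ) : ℝ :=
  2 * (c * (3 * (μ0 ^ 2 * L1 ^ 2 + 2 * L2 ^ 2)) + L2 ^ 2)

/-- The influence of the averaged noise on the descent of the potential. -/
def noiseConst (L1 L2 : ℝ≥0) (γ μ0 c : ℝ) : ℝ :=
  4 * smoothConst L1 L2 γ μ0 * (3 * c ^ 2 * (μ0 ^ 2 + 1) + 1)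

/-- The growth of the consensus error in one iteration. -/
def consensusConst (L1 L2 : ℝ≥0) (γ μ0 c : ℝ) : ℝ :=
  (1 + c ^ 2) * (21 * (μ0 ^ 2 * (L1 ^ 2 + 1) + 2 * L2 ^ 2 + 2) + 14 / γ ^ 2)

theorem smoothConst_pos {L1 L2 : ℝ≥0} {γ μ0 : ℝ} (hγ : 0 < γ) (hμ : 0 ≤ μ0) :
    0 < smoothConst L1 L2 γ μ0 := by
  unfold smoothConst; positivity

theorem biasConst_nonneg {L1 L2 : ℝ≥0} {μ0 c : ℝ} (hc : 0 ≤ c) : 0 ≤ biasConst L1 L2 μ0 c := by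
  unfold biasConst; positivity

theorem noiseConst_pos {L1 L2 : ℝ≥0} {γ μ0 c : ℝ} (hγ : 0 < γ) (hμ : 0 ≤ μ0) :
    0 < noiseConst L1 L2 γ μ0 c := by
  have := smoothConst_pos (L1 := L1) (L2 := L2) hγ hμ
  unfold noiseConst; positivity

theorem consensusConst_nonneg {L1 L2 : ℝ≥0} {γ μ0 c : ℝ} : 0 ≤ consensusConst L1 L2 γ μ0 c := by
  unfold consensusConst; positivity

end Constants

namespace Problem

variable {n dx dy : ℕ} {Ξf Ξg : Type*} [MeasurableSpace Ξf] [MeasurableSpace Ξg]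
variable {Q : Problem n dx dy Ξf Ξg} {L1 L2 : ℝ≥0} {γ μ μ0 Flow c l : ℝ}

theorem IsSmooth.isProxRegular (h : Q.IsSmooth L1 L2) (hn : 0 < n) (hγ : 0 < γ)
    (hγ' : L2 < 1 / (2 * γ)) : Q.IsProxRegular L2 γ :=
  ⟨h.differentiable_G, h.lipschitz_G hn, hγ, hγ'⟩

theorem IsProxRegular.hasGradientAt_Psi (h : Q.IsProxRegular L2 γ) (hF : Differentiable ℝ Q.F)
    (z : Pair dx dy) : HasGradientAt (Q.Psi γ μ) (Q.gradPsi γ μ z) z := by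
  have h1 := hasGradientAt_gradient hF z
  have h2 := hasGradientAt_gradient h.differentiable z
  have h3 := h.hasGradientAt_moreau z
  rw [hasGradientAt_iff_hasFDerivAt] at *
  have := ((h1.const_mul μ).add h2).sub h3
  rw [gradPsi, map_sub, map_add, map_smul]
  exact this

theorem IsProxRegular.potential_add_le (h : Q.IsProxRegular L2 γ) (hF : Differentiable ℝ Q.F)
    (hL : LipschitzWith L1 (∇ Q.F)) (hμ : 0 ≤ μ) (hμ' : μ ≤ μ0) (z u : Pair dx dy) (θ w : Vec dy) :
    Q.potential γ μ Flow (z + u) (θ + w) ≤ Q.potential γ μ Flow z θ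
      + inner ℝ (Q.gradPsi γ μ z + (Q.envGrad γ z θ - Q.envGrad γ z (Q.proxPoint γ z))) u
      + inner ℝ (Q.proxGrad γ z θ) w + smoothConst L1 L2 γ μ0 * (‖u‖ ^ 2 + ‖w‖ ^ 2) := by
  have h1 := (abs_le.1 (abs_expansion_le_of_lipschitz_gradient hF hL z u)).2
  have h2 := (abs_le.1 (abs_expansion_le_of_lipschitz_gradient h.differentiable h.lipschitz z u)).2
  have h3 := (abs_le.1 (abs_proxObjective_expansion_le h.differentiable h.lipschitz h.pos
    z u θ w)).2
  have h4 := (abs_le.1 (h.abs_moreau_expansion_le z u)).1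
  have hγ := h.pos
  set V := (L2 + 1 / γ) * (1 + ((L2 + 1 / γ) / (1 / γ - L2)) ^ 2) with hV
  have hV0 : 0 ≤ V := by positivity
  have h1' : μ * (Q.F (z + u) - Q.F z - inner ℝ (∇ Q.F z) u) ≤ μ0 * (L1 * ‖u‖ ^ 2) :=
    (mul_le_mul_of_nonneg_left h1 hμ).trans (by gcongr)
  have hw : 0 ≤ (μ0 * L1 + L2 + 2 * V) * ‖w‖ ^ 2 := by
    have := hμ.trans hμ'; positivity
  have e : inner ℝ (Q.gradPsi γ μ z + (Q.envGrad γ z θ - Q.envGrad γ z (Q.proxPoint γ z))) u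
      = μ * inner ℝ (∇ Q.F z) u + inner ℝ (∇ Q.G z) u + inner ℝ (Q.envGrad γ z θ) u
        - 2 * inner ℝ (Q.envGrad γ z (Q.proxPoint γ z)) u := by
    simp only [gradPsi, inner_add_left, inner_sub_left, real_inner_smul_left]; ring
  rw [e]
  unfold potential smoothConst
  rw [← hV]
  linarith

theorem IsProxRegular.norm_envGrad_gap_sq_le (h : Q.IsProxRegular L2 γ) (z : Pair dx dy)
    (θ : Vec dy) : ‖Q.envGrad γ z θ - Q.envGrad γ z (Q.proxPoint γ z)‖ ^ 2
      ≤ (L2 ^ 2 + 1 / γ ^ 2) / (1 / γ - L2) ^ 2 * ‖Q.proxGrad γ z θ‖ ^ 2 := by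
  refine (h.norm_envGrad_sub_sq_le z θ _).trans ?_
  rw [div_mul_eq_mul_div, mul_div_assoc]
  have := h.gap_pos
  gcongr
  rw [le_div_iff₀ (by positivity), ← mul_pow, mul_comm]
  gcongr
  exact h.gap_mul_norm_sub_proxPoint_le z θ

variable {W : Matrix (Fin n) (Fin n) ℝ}

variable (Q) in
/-- The averaged noise of the direction of the upper variable. -/
def upperNoise (μ : ℝ) (s : State n dx dy) (ξf : Fin n → Ξf) (ξg : Fin n → Ξg) : Pair dx dy :=
  μ • avg (Q.errF s ξf) + avg (Q.errG s ξg) - dropSnd (avg (Q.errH s ξg))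

variable (Q) in
/-- The terms of the descent of the potential that are linear in the noise. -/
def linearNoise (γ μ c l : ℝ) (s : State n dx dy) (ξf : Fin n → Ξf) (ξg : Fin n → Ξg) : ℝ :=
  c * l * inner ℝ (Q.gradPsi γ μ s.mean
      + (Q.envGrad γ s.mean (avg s.θ) - Q.envGrad γ s.mean (Q.proxPoint γ s.mean)))
      (Q.upperNoise μ s ξf ξg)
    + l * inner ℝ (Q.proxGrad γ s.mean (avg s.θ)) (avg (Q.errH s ξg)).snd

/-- One iteration decreases the potential, up to noise and consensus error. -/
theorem IsSmooth.potential_step_le (hQ : Q.IsSmooth L1 L2) (hn : 0 < n) (hγ : 0 < γ)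
    (hγ' : L2 < 1 / (2 * γ)) (hW : IsWeightMatrix W) (hμ : 0 ≤ μ) (hμ' : μ ≤ μ0) (hl : 0 < l)
    (hc : 0 < c) (hκ : c * ((L2 ^ 2 + 1 / γ ^ 2) / (1 / γ - L2) ^ 2) ≤ 1 / 16)
    (h1 : 16 * smoothConst L1 L2 γ μ0 * (c * l) ≤ 1) (h2 : 12 * smoothConst L1 L2 γ μ0 * l ≤ 1)
    (s : State n dx dy) (ξf : Fin n → Ξf) (ξg : Fin n → Ξg) :
    Q.potential γ μ Flow (Q.step γ μ s W l (c * l) (c * l) ξf ξg).mean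
        (avg (Q.step γ μ s W l (c * l) (c * l) ξf ξg).θ)
      ≤ Q.potential γ μ Flow s.mean (avg s.θ) - c * l / 4 * ‖Q.gradPsi γ μ s.mean‖ ^ 2
        + l * biasConst L1 L2 μ0 c * s.consensusError - Q.linearNoise γ μ c l s ξf ξg
        + noiseConst L1 L2 γ μ0 c * l ^ 2 * (‖avg (Q.errF s ξf)‖ ^ 2 + ‖avg (Q.errG s ξg)‖ ^ 2
          + ‖avg (Q.errH s ξg)‖ ^ 2) := by
  have h := hQ.isProxRegular hn hγ hγ'
  have hμ0 : 0 ≤ μ0 := hμ.trans hμ'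
  have hM := smoothConst_pos (L1 := L1) (L2 := L2) hγ hμ0
  have hμsq : μ ^ 2 ≤ μ0 ^ 2 := by gcongr
  rw [step_mean_eq hW, step_avg_θ_eq hW]
  refine (h.potential_add_le hQ.differentiable_F (hQ.lipschitz_F hn) hμ hμ' _ _ _ _).trans ?_
  have hd := perturbed_descent_le (q := Q.gradPsi γ μ s.mean)
    (r := Q.envGrad γ s.mean (avg s.θ) - Q.envGrad γ s.mean (Q.proxPoint γ s.mean))
    (e := μ • Q.biasF s + Q.biasG s - dropSnd (Q.biasH s)) (N := Q.upperNoise μ s ξf ξg)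
    (g := Q.proxGrad γ s.mean (avg s.θ)) (e' := (Q.biasH s).snd)
    (N' := (avg (Q.errH s ξg)).snd) hl hc hM.le (h.norm_envGrad_gap_sq_le _ _) hκ h1 h2
  have three : ∀ a b d : Pair dx dy, ‖μ • a + b - dropSnd d‖ ^ 2
      ≤ 3 * (μ0 ^ 2 * ‖a‖ ^ 2 + ‖b‖ ^ 2 + ‖d‖ ^ 2) := fun a b d => by
    have := norm_add_sq_le_three (μ • a) b (-dropSnd d)
    rw [← sub_eq_add_neg, norm_smul, norm_neg, mul_pow, Real.norm_eq_abs, sq_abs] at this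
    refine this.trans ?_
    gcongr
    exact norm_dropSnd_le d
  have hΔ := s.consensusError_nonneg
  have he : ‖μ • Q.biasF s + Q.biasG s - dropSnd (Q.biasH s)‖ ^ 2
      ≤ 3 * (μ0 ^ 2 * L1 ^ 2 + 2 * L2 ^ 2) * s.consensusError := by
    refine (three _ _ _).trans ?_
    have := mul_le_mul_of_nonneg_left (hQ.norm_biasF_sq_le s) (sq_nonneg μ0)
    have := hQ.norm_biasG_sq_le s
    have := hQ.norm_biasH_sq_le s
    linarith
  have he' : ‖(Q.biasH s).snd‖ ^ 2 ≤ L2 ^ 2 * s.consensusError := by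
    refine le_trans ?_ (hQ.norm_biasH_sq_le s)
    gcongr
    exact norm_snd_le _
  have hN := three (avg (Q.errF s ξf)) (avg (Q.errG s ξg)) (avg (Q.errH s ξg))
  have hN' : ‖(avg (Q.errH s ξg)).snd‖ ^ 2 ≤ ‖avg (Q.errH s ξg)‖ ^ 2 := by
    gcongr; exact norm_snd_le _
  have t1 : 2 * l * (c * ‖μ • Q.biasF s + Q.biasG s - dropSnd (Q.biasH s)‖ ^ 2
      + ‖(Q.biasH s).snd‖ ^ 2) ≤ l * biasConst L1 L2 μ0 c * s.consensusError := by
    calc _ ≤ 2 * l * (c * (3 * (μ0 ^ 2 * L1 ^ 2 + 2 * L2 ^ 2) * s.consensusError)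
          + L2 ^ 2 * s.consensusError) := by gcongr
      _ = _ := by unfold biasConst; ring
  have t2 : 4 * smoothConst L1 L2 γ μ0 * l ^ 2 * (c ^ 2 * ‖Q.upperNoise μ s ξf ξg‖ ^ 2
        + ‖(avg (Q.errH s ξg)).snd‖ ^ 2)
      ≤ noiseConst L1 L2 γ μ0 c * l ^ 2 * (‖avg (Q.errF s ξf)‖ ^ 2 + ‖avg (Q.errG s ξg)‖ ^ 2
          + ‖avg (Q.errH s ξg)‖ ^ 2) := by
    set a := ‖avg (Q.errF s ξf)‖ ^ 2
    set b := ‖avg (Q.errG s ξg)‖ ^ 2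
    set d := ‖avg (Q.errH s ξg)‖ ^ 2
    have ha : 0 ≤ a := sq_nonneg _
    have hb : 0 ≤ b := sq_nonneg _
    have hd : 0 ≤ d := sq_nonneg _
    have : c ^ 2 * ‖Q.upperNoise μ s ξf ξg‖ ^ 2 + ‖(avg (Q.errH s ξg)).snd‖ ^ 2
        ≤ (3 * c ^ 2 * (μ0 ^ 2 + 1) + 1) * (a + b + d) := by
      calc _ ≤ c ^ 2 * (3 * (μ0 ^ 2 * a + b + d)) + d := by gcongr; exact hN
        _ ≤ _ := by
          have : 0 ≤ c ^ 2 * (a + μ0 ^ 2 * b + μ0 ^ 2 * d) := by positivity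
          linarith
    calc _ ≤ 4 * smoothConst L1 L2 γ μ0 * l ^ 2
          * ((3 * c ^ 2 * (μ0 ^ 2 + 1) + 1) * (a + b + d)) := by gcongr
      _ = _ := by unfold noiseConst; ring
  simp only [linearNoise]
  simp only [upperNoise] at hd t2 ⊢
  linarith

section Consensus

/-- The mean squared noise of the agents. -/
def meanNoise (Q : Problem n dx dy Ξf Ξg) (s : State n dx dy) (ξf : Fin n → Ξf)
    (ξg : Fin n → Ξg) : ℝ :=
  avg fun i => ‖Q.errF s ξf i‖ ^ 2 + ‖Q.errG s ξg i‖ ^ 2 + ‖Q.errH s ξg i‖ ^ 2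

theorem avg_norm_sample_sub_sq_le {E Ξ : Type*} [NormedAddCommGroup E] [InnerProductSpace ℝ E]
    {φ : Fin n → E → E} {ψ : E → E} {L : ℝ≥0} {σ : ℝ} (h : ∀ i, LipschitzWith L (φ i))
    (z : Fin n → E) (w : E) (hσ : (avg fun i => ‖φ i w - ψ w‖ ^ 2) ≤ σ ^ 2)
    (S : Fin n → E → Ξ → E) (ξ : Fin n → Ξ) :
    (avg fun i => ‖S i (z i) (ξ i) - ψ w‖ ^ 2)
      ≤ 3 * ((avg fun i => ‖S i (z i) (ξ i) - φ i (z i)‖ ^ 2)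
        + L ^ 2 * (avg fun i => ‖z i - w‖ ^ 2) + σ ^ 2) := by
  have h1 : ∀ i, ‖S i (z i) (ξ i) - ψ w‖ ^ 2 ≤ 3 * (‖S i (z i) (ξ i) - φ i (z i)‖ ^ 2
      + L ^ 2 * ‖z i - w‖ ^ 2 + ‖φ i w - ψ w‖ ^ 2) := fun i => by
    have := norm_add_sq_le_three (S i (z i) (ξ i) - φ i (z i)) (φ i (z i) - φ i w) (φ i w - ψ w)
    rw [sub_add_sub_cancel, sub_add_sub_cancel] at this
    refine this.trans ?_
    have h2 := (h i).dist_le_mul (z i) w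
    rw [dist_eq_norm, dist_eq_norm] at h2
    rw [← mul_pow]
    gcongr
  refine (avg_mono h1).trans ?_
  simp only [← smul_eq_mul, avg_smul, avg_add]
  simp only [smul_eq_mul]
  gcongr

/-- One iteration contracts the consensus error, up to noise and dissimilarity. -/
theorem IsSmooth.consensusError_step_le (hQ : Q.IsSmooth L1 L2) (hγ : 0 < γ)
    {σf σg : ℝ} (hσ : Q.HasBoundedDissimilarity σf σg) (hW : IsWeightMatrix W)
    (hρ : connectivity W hW.isHermitian < 1) (hμ : 0 ≤ μ) (hμ' : μ ≤ μ0)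
    (s : State n dx dy) (ξf : Fin n → Ξf) (ξg : Fin n → Ξg) :
    (Q.step γ μ s W l (c * l) (c * l) ξf ξg).consensusError
      ≤ connectivity W hW.isHermitian * s.consensusError
        + 2 / (1 - connectivity W hW.isHermitian) * l ^ 2 * (consensusConst L1 L2 γ μ0 c *
          (s.consensusError + (σf ^ 2 + σg ^ 2) + Q.meanNoise s ξf ξg)) := by
  have hρ1 : 0 < 1 - connectivity W hW.isHermitian := sub_pos.2 hρ
  have hx := hW.avg_norm_sub_avg_sq_le hρ s.x (fun j => Q.dirx μ s (ξf j) (ξg j) j)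
    (μ • (∇ Q.F s.mean).fst + (∇ Q.G s.mean).fst - (∇ Q.G s.lowerMean).fst) (c * l)
  have hy := hW.avg_norm_sub_avg_sq_le hρ s.y (fun j => Q.diry γ μ s (ξf j) (ξg j) j)
    (μ • (∇ Q.F s.mean).snd + (∇ Q.G s.mean).snd - (1 / γ) • (avg s.y - avg s.θ)) (c * l)
  have hθ := hW.avg_norm_sub_avg_sq_le hρ s.θ (fun j => Q.dirθ γ s (ξg j) j)
    ((∇ Q.G s.lowerMean).snd + (1 / γ) • (avg s.θ - avg s.y)) l
  set ρ := connectivity W hW.isHermitian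
  set A : Fin n → ℝ := fun i => ‖Q.gradF i (pair (s.x i) (s.y i)) (ξf i) - ∇ Q.F s.mean‖ ^ 2
  set B : Fin n → ℝ := fun i => ‖Q.gradG i (pair (s.x i) (s.y i)) (ξg i) - ∇ Q.G s.mean‖ ^ 2
  set C : Fin n → ℝ := fun i => ‖Q.gradG i (pair (s.x i) (s.θ i)) (ξg i) - ∇ Q.G s.lowerMean‖ ^ 2
  set Y : Fin n → ℝ := fun i => ‖s.x i - avg s.x‖ ^ 2 + ‖s.y i - avg s.y‖ ^ 2
    + ‖s.θ i - avg s.θ‖ ^ 2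
  have hA : avg A ≤ 3 * ((avg fun i => ‖Q.errF s ξf i‖ ^ 2) + L1 ^ 2 * s.consensusError
      + σf ^ 2) := by
    refine (avg_norm_sample_sub_sq_le hQ.lipschitz_f (fun i => pair (s.x i) (s.y i)) s.mean
      (hσ.bound_f _) Q.gradF ξf).trans ?_
    gcongr
    · exact le_rfl
    · exact s.avg_norm_sub_mean_sq_le
  have hB : avg B ≤ 3 * ((avg fun i => ‖Q.errG s ξg i‖ ^ 2) + L2 ^ 2 * s.consensusError
      + σg ^ 2) := by
    refine (avg_norm_sample_sub_sq_le hQ.lipschitz_g (fun i => pair (s.x i) (s.y i)) s.mean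
      (hσ.bound_g _) Q.gradG ξg).trans ?_
    gcongr
    · exact le_rfl
    · exact s.avg_norm_sub_mean_sq_le
  have hC : avg C ≤ 3 * ((avg fun i => ‖Q.errH s ξg i‖ ^ 2) + L2 ^ 2 * s.consensusError
      + σg ^ 2) := by
    refine (avg_norm_sample_sub_sq_le hQ.lipschitz_g (fun i => pair (s.x i) (s.θ i)) s.lowerMean
      (hσ.bound_g _) Q.gradG ξg).trans ?_
    gcongr
    · exact le_rfl
    · exact s.avg_norm_sub_lowerMean_sq_le
  have hμsq : μ ^ 2 ≤ μ0 ^ 2 := by gcongr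
  have hfst : ∀ v : Pair dx dy, ‖v.fst‖ ^ 2 ≤ ‖v‖ ^ 2 := fun v => by
    gcongr; exact norm_fst_le v
  have hsnd : ∀ v : Pair dx dy, ‖v.snd‖ ^ 2 ≤ ‖v‖ ^ 2 := fun v => by
    gcongr; exact norm_snd_le v
  have hsm : ∀ v : Vec dy, ‖(1 / γ) • v‖ ^ 2 = 1 / γ ^ 2 * ‖v‖ ^ 2 := fun v => by
    rw [norm_smul, mul_pow, Real.norm_eq_abs, sq_abs, div_pow, one_pow]
  have hyθ : ∀ i, ‖(s.y i - avg s.y) - (s.θ i - avg s.θ)‖ ^ 2 ≤ 2 * Y i := fun i => by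
    have := norm_add_sq_le_two (s.y i - avg s.y) (-(s.θ i - avg s.θ))
    rw [norm_neg, ← sub_eq_add_neg] at this
    have := sq_nonneg ‖s.x i - avg s.x‖
    simp only [Y]; linarith
  have bx : ∀ i, ‖Q.dirx μ s (ξf i) (ξg i) i
      - (μ • (∇ Q.F s.mean).fst + (∇ Q.G s.mean).fst - (∇ Q.G s.lowerMean).fst)‖ ^ 2
      ≤ 3 * (μ0 ^ 2 * A i + B i + C i) := fun i => by
    have e : Q.dirx μ s (ξf i) (ξg i) i
        - (μ • (∇ Q.F s.mean).fst + (∇ Q.G s.mean).fst - (∇ Q.G s.lowerMean).fst)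
        = μ • (Q.gradF i (pair (s.x i) (s.y i)) (ξf i) - ∇ Q.F s.mean).fst
          + (Q.gradG i (pair (s.x i) (s.y i)) (ξg i) - ∇ Q.G s.mean).fst
          + -(Q.gradG i (pair (s.x i) (s.θ i)) (ξg i) - ∇ Q.G s.lowerMean).fst := by
      simp only [dirx, WithLp.sub_fst]; module
    rw [e]
    refine (norm_add_sq_le_three _ _ _).trans ?_
    rw [norm_neg, norm_smul, mul_pow, Real.norm_eq_abs, sq_abs]
    gcongr <;> exact hfst _
  have by' : ∀ i, ‖Q.diry γ μ s (ξf i) (ξg i) i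
      - (μ • (∇ Q.F s.mean).snd + (∇ Q.G s.mean).snd - (1 / γ) • (avg s.y - avg s.θ))‖ ^ 2
      ≤ 3 * (μ0 ^ 2 * A i + B i + 1 / γ ^ 2 * (2 * Y i)) := fun i => by
    have e : Q.diry γ μ s (ξf i) (ξg i) i
        - (μ • (∇ Q.F s.mean).snd + (∇ Q.G s.mean).snd - (1 / γ) • (avg s.y - avg s.θ))
        = μ • (Q.gradF i (pair (s.x i) (s.y i)) (ξf i) - ∇ Q.F s.mean).snd
          + (Q.gradG i (pair (s.x i) (s.y i)) (ξg i) - ∇ Q.G s.mean).snd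
          + -((1 / γ) • ((s.y i - avg s.y) - (s.θ i - avg s.θ))) := by
      simp only [diry, WithLp.sub_snd]; module
    rw [e]
    refine (norm_add_sq_le_three _ _ _).trans ?_
    rw [norm_neg, hsm, norm_smul, mul_pow, Real.norm_eq_abs, sq_abs]
    gcongr
    · exact hsnd _
    · exact hsnd _
    · exact hyθ i
  have bθ : ∀ i, ‖Q.dirθ γ s (ξg i) i
      - ((∇ Q.G s.lowerMean).snd + (1 / γ) • (avg s.θ - avg s.y))‖ ^ 2
      ≤ 2 * (C i + 1 / γ ^ 2 * (2 * Y i)) := fun i => by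
    have e : Q.dirθ γ s (ξg i) i
        - ((∇ Q.G s.lowerMean).snd + (1 / γ) • (avg s.θ - avg s.y))
        = (Q.gradG i (pair (s.x i) (s.θ i)) (ξg i) - ∇ Q.G s.lowerMean).snd
          + -((1 / γ) • ((s.y i - avg s.y) - (s.θ i - avg s.θ))) := by
      simp only [dirθ, WithLp.sub_snd]; module
    rw [e]
    refine (norm_add_sq_le_two _ _).trans ?_
    rw [norm_neg, hsm]
    gcongr
    · exact hsnd _
    · exact hyθ i
  have ax := avg_mono bx
  have ay := avg_mono by'
  have aθ := avg_mono bθ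
  have hYavg : avg Y = s.consensusError := rfl
  have mN : Q.meanNoise s ξf ξg = (avg fun i => ‖Q.errF s ξf i‖ ^ 2)
      + (avg fun i => ‖Q.errG s ξg i‖ ^ 2) + avg fun i => ‖Q.errH s ξg i‖ ^ 2 := by
    unfold meanNoise; rw [avg_add, avg_add]
  simp only [← smul_eq_mul, avg_smul, avg_add] at ax ay aθ
  simp only [smul_eq_mul] at ax ay aθ
  set dX := avg fun i => ‖Q.dirx μ s (ξf i) (ξg i) i
      - (μ • (∇ Q.F s.mean).fst + (∇ Q.G s.mean).fst - (∇ Q.G s.lowerMean).fst)‖ ^ 2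
  set dY := avg fun i => ‖Q.diry γ μ s (ξf i) (ξg i) i
      - (μ • (∇ Q.F s.mean).snd + (∇ Q.G s.mean).snd - (1 / γ) • (avg s.y - avg s.θ))‖ ^ 2
  set dθ := avg fun i => ‖Q.dirθ γ s (ξg i) i
      - ((∇ Q.G s.lowerMean).snd + (1 / γ) • (avg s.θ - avg s.y))‖ ^ 2
  have hdX : 0 ≤ dX := avg_nonneg fun _ => by positivity
  have hdY : 0 ≤ dY := avg_nonneg fun _ => by positivity
  have hdθ : 0 ≤ dθ := avg_nonneg fun _ => by positivity
  have hsplit : ∀ t : State n dx dy, t.consensusError = (avg fun i => ‖t.x i - avg t.x‖ ^ 2)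
      + (avg fun i => ‖t.y i - avg t.y‖ ^ 2) + avg fun i => ‖t.θ i - avg t.θ‖ ^ 2 := fun t => by
    unfold State.consensusError; rw [avg_add, avg_add]
  have htotal : dX + dY + dθ ≤ (21 * (μ0 ^ 2 * (L1 ^ 2 + 1) + 2 * L2 ^ 2 + 2) + 14 / γ ^ 2)
      * (s.consensusError + (σf ^ 2 + σg ^ 2) + Q.meanNoise s ξf ξg) := by
    rw [hYavg] at ay aθ
    rw [mN]
    have ha : 0 ≤ avg fun i => ‖Q.errF s ξf i‖ ^ 2 := avg_nonneg fun _ => by positivity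
    have hb : 0 ≤ avg fun i => ‖Q.errG s ξg i‖ ^ 2 := avg_nonneg fun _ => by positivity
    have hd : 0 ≤ avg fun i => ‖Q.errH s ξg i‖ ^ 2 := avg_nonneg fun _ => by positivity
    have hΔ := s.consensusError_nonneg
    generalize (avg fun i => ‖Q.errF s ξf i‖ ^ 2) = a at *
    generalize (avg fun i => ‖Q.errG s ξg i‖ ^ 2) = b at *
    generalize (avg fun i => ‖Q.errH s ξg i‖ ^ 2) = d at *
    generalize s.consensusError = Δ at *
    have hA' := mul_le_mul_of_nonneg_left hA (sq_nonneg μ0)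
    have p0 : 0 ≤ Δ + (σf ^ 2 + σg ^ 2) + (a + b + d) := by positivity
    have p1 : 0 ≤ μ0 ^ 2 * (b + d + σg ^ 2 + Δ) := by positivity
    have p2 : 0 ≤ μ0 ^ 2 * (a + σf ^ 2) := by positivity
    have p3 : 0 ≤ μ0 ^ 2 * L1 ^ 2 * (a + b + d + σf ^ 2 + σg ^ 2) := by positivity
    have p4 : 0 ≤ μ0 ^ 2 * L1 ^ 2 * Δ := by positivity
    have p5 : 0 ≤ (L2 : ℝ) ^ 2 * (a + b + d + σf ^ 2 + σg ^ 2) := by positivity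
    have p6 : 0 ≤ (L2 : ℝ) ^ 2 * Δ := by positivity
    have p7 : 0 ≤ 1 / γ ^ 2 * (a + b + d + σf ^ 2 + σg ^ 2) := by positivity
    have p8 : 0 ≤ 1 / γ ^ 2 * Δ := by positivity
    have hgam : 14 / γ ^ 2 = 14 * (1 / γ ^ 2) := by ring
    rw [hgam]
    generalize 1 / γ ^ 2 = γ' at *
    calc _ ≤ 6 * (μ0 ^ 2 * avg A) + 6 * avg B + 5 * avg C + 10 * (γ' * Δ) := by linarith
      _ ≤ 18 * (μ0 ^ 2 * (a + L1 ^ 2 * Δ + σf ^ 2)) + 18 * (b + L2 ^ 2 * Δ + σg ^ 2)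
        + 15 * (d + L2 ^ 2 * Δ + σg ^ 2) + 10 * (γ' * Δ) := by linarith
      _ ≤ _ := by
        have q1 := sq_nonneg σf
        have q2 := sq_nonneg σg
        linarith
  have hΔ' : (Q.step γ μ s W l (c * l) (c * l) ξf ξg).consensusError
      ≤ ρ * s.consensusError + 2 / (1 - ρ) * l ^ 2 * (c ^ 2 * dX + c ^ 2 * dY + dθ) := by
    rw [hsplit, hsplit s]
    simp only [mul_pow] at hx hy
    refine (add_le_add (add_le_add hx hy) hθ).trans_eq ?_
    ring
  refine hΔ'.trans ?_
  have hc2 : c ^ 2 * dX + c ^ 2 * dY + dθ ≤ (1 + c ^ 2) * (dX + dY + dθ) := by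
    have := sq_nonneg c
    have : 0 ≤ c ^ 2 * dθ := by positivity
    linarith
  unfold consensusConst
  rw [mul_assoc (1 + c ^ 2)]
  gcongr
  refine hc2.trans ?_
  gcongr

end Consensus

end Problem

section Noise

variable {Ω : Type*} [MeasurableSpace Ω] {P : Measure Ω}

/-- The mean of `n` independent centered vectors has a variance that is smaller by a factor `n`. -/
theorem integral_norm_avg_sq_le {n : ℕ} (hn : 0 < n) {E : Type*} [NormedAddCommGroup E]
    [InnerProductSpace ℝ E] [CompleteSpace E] [MeasurableSpace E] [BorelSpace E]
    {X : Fin n → Ω → E} {v : ℝ} (hX : ∀ i, Integrable (X i) P) (h0 : ∀ i, ∫ ω, X i ω ∂P = 0)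
    (h2 : ∀ i, Integrable (fun ω => ‖X i ω‖ ^ 2) P) (hv : ∀ i, ∫ ω, ‖X i ω‖ ^ 2 ∂P ≤ v)
    (hind : ∀ i j, i ≠ j → IndepFun (X i) (X j) P) :
    Integrable (fun ω => avg fun i => X i ω) P ∧ ∫ ω, (avg fun i => X i ω) ∂P = 0 ∧
      Integrable (fun ω => ‖avg fun i => X i ω‖ ^ 2) P ∧
      ∫ ω, ‖avg fun i => X i ω‖ ^ 2 ∂P ≤ v / n := by
  have hn' : (n : ℝ) ≠ 0 := by positivity
  have hI : ∀ i j, Integrable (fun ω => inner ℝ (X i ω) (X j ω)) P := fun i j => by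
    by_cases hij : i = j
    · subst hij
      simpa only [real_inner_self_eq_norm_sq] using h2 i
    · exact (hind i j hij).integrable_bilin (hX i) (hX j) (innerSL ℝ)
  have hexp : ∀ ω, ‖avg fun i => X i ω‖ ^ 2
      = ((n : ℝ)⁻¹) ^ 2 * ∑ i, ∑ j, inner ℝ (X i ω) (X j ω) := fun ω => by
    rw [avg, norm_smul, mul_pow, Real.norm_eq_abs, sq_abs, ← real_inner_self_eq_norm_sq, sum_inner]
    simp only [inner_sum]
  refine ⟨?_, ?_, ?_, ?_⟩
  · unfold avg
    exact (integrable_finsetSum _ fun i _ => hX i).smul _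
  · unfold avg
    rw [integral_smul, integral_finsetSum _ fun i _ => hX i]
    simp [h0]
  · simp only [hexp]
    exact (integrable_finsetSum _ fun i _ => integrable_finsetSum _ fun j _ => hI i j).const_mul _
  · simp only [hexp]
    rw [integral_const_mul, integral_finsetSum _
      fun i _ => integrable_finsetSum _ fun j _ => hI i j]
    have hrow : ∀ i, ∫ ω, ∑ j, inner ℝ (X i ω) (X j ω) ∂P ≤ v := fun i => by
      rw [integral_finsetSum _ fun j _ => hI i j, Finset.sum_eq_single i]
      · simpa only [real_inner_self_eq_norm_sq] using hv i
      · intro j _ hj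
        have := (hind i j hj.symm).integral_bilin (hX i) (hX j) (innerSL ℝ)
        exact this.trans (by rw [h0 i]; simp)
      · simp
    calc _ ≤ ((n : ℝ)⁻¹) ^ 2 * ∑ i : Fin n, v := by
          gcongr with i
          exact hrow i
      _ = v / n := by
        rw [Finset.sum_const, Finset.card_univ, Fintype.card_fin, nsmul_eq_mul]
        field_simp

theorem integral_avg_le {n : ℕ} (hn : 0 < n) {X : Fin n → Ω → ℝ} {v : ℝ}
    (hX : ∀ i, Integrable (X i) P) (hv : ∀ i, ∫ ω, X i ω ∂P ≤ v) :
    ∫ ω, (avg fun i => X i ω) ∂P ≤ v := by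
  unfold avg
  rw [integral_smul, integral_finsetSum _ fun i _ => hX i]
  calc _ ≤ avg fun _ : Fin n => v := by
        exact avg_mono hv
    _ = v := avg_const hn v

theorem integrable_add_three {a b d : Ω → ℝ} {u v w : ℝ} (ha : Integrable a P)
    (hb : Integrable b P) (hd : Integrable d P) (hu : ∫ ω, a ω ∂P ≤ u) (hv : ∫ ω, b ω ∂P ≤ v)
    (hw : ∫ ω, d ω ∂P ≤ w) :
    Integrable (fun ω => a ω + b ω + d ω) P ∧ ∫ ω, a ω + b ω + d ω ∂P ≤ u + v + w := by
  have hab : Integrable (fun ω => a ω + b ω) P := ha.add hb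
  refine ⟨hab.add hd, ?_⟩
  rw [integral_add hab hd, integral_add ha hb]
  linarith

theorem integrable_const_inner_of_integral_eq_zero {E : Type*} [NormedAddCommGroup E]
    [InnerProductSpace ℝ E] [CompleteSpace E] {X : Ω → E} (hX : Integrable X P)
    (h0 : ∫ ω, X ω ∂P = 0) (v : E) :
    Integrable (fun ω => inner ℝ v (X ω)) P ∧ ∫ ω, inner ℝ v (X ω) ∂P = 0 :=
  ⟨hX.const_inner v, by rw [integral_inner hX, h0, inner_zero_right]⟩

theorem lintegral_ofReal_le_of_le_affine [IsProbabilityMeasure P] {X l S N : Ω → ℝ}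
    {a k₁ k₂ σ v w : ℝ} (hX : ∀ ω, 0 ≤ X ω)
    (h : ∀ ω, X ω ≤ a - l ω + k₁ * S ω + k₂ * (σ + N ω)) (hk₁ : 0 ≤ k₁) (hk₂ : 0 ≤ k₂)
    (hl : Integrable l P) (hl0 : ∫ ω, l ω ∂P = 0) (hS : Integrable S P) (hSv : ∫ ω, S ω ∂P ≤ v)
    (hN : Integrable N P) (hNw : ∫ ω, N ω ∂P ≤ w) :
    0 ≤ a + k₁ * v + k₂ * (σ + w) ∧
      ∫⁻ ω, ENNReal.ofReal (X ω) ∂P ≤ ENNReal.ofReal (a + k₁ * v + k₂ * (σ + w)) := by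
  have i1 : Integrable (fun ω => a - l ω) P := (integrable_const a).sub hl
  have i2 : Integrable (fun ω => k₁ * S ω) P := hS.const_mul k₁
  have i12 : Integrable (fun ω => a - l ω + k₁ * S ω) P := i1.add i2
  have i3 : Integrable (fun ω => k₂ * (σ + N ω)) P := ((integrable_const σ).add hN).const_mul k₂
  have i4 : Integrable (fun ω => a - l ω + k₁ * S ω + k₂ * (σ + N ω)) P := i12.add i3
  have e : ∫ ω, a - l ω + k₁ * S ω + k₂ * (σ + N ω) ∂P ≤ a + k₁ * v + k₂ * (σ + w) := by
    rw [integral_add i12 i3, integral_add i1 i2, integral_sub (integrable_const a) hl,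
      integral_const_mul, integral_const_mul, integral_add (integrable_const σ) hN, hl0]
    simp only [integral_const, probReal_univ, one_smul, sub_zero]
    gcongr
  refine ⟨le_trans (integral_nonneg fun ω => (hX ω).trans (h ω)) e, ?_⟩
  calc _ ≤ ∫⁻ ω, ENNReal.ofReal (a - l ω + k₁ * S ω + k₂ * (σ + N ω)) ∂P :=
        lintegral_mono fun ω => ENNReal.ofReal_le_ofReal (h ω)
    _ = ENNReal.ofReal (∫ ω, a - l ω + k₁ * S ω + k₂ * (σ + N ω) ∂P) :=
        (ofReal_integral_eq_lintegral_ofReal i4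
          (Filter.Eventually.of_forall fun ω => (hX ω).trans (h ω))).symm
    _ ≤ _ := ENNReal.ofReal_le_ofReal e

end Noise

namespace Problem

variable {n dx dy : ℕ} {Ξf Ξg : Type*} [MeasurableSpace Ξf] [MeasurableSpace Ξg]
variable {Q : Problem n dx dy Ξf Ξg} {L1 L2 : ℝ≥0} {γ μ μ' μ0 Flow c l : ℝ}
variable {W : Matrix (Fin n) (Fin n) ℝ}

variable (Q) in
/-- The potential plus a multiple of the consensus error. -/
def lyapunov (γ μ Flow w : ℝ) (s : State n dx dy) : ℝ :=
  Q.potential γ μ Flow s.mean (avg s.θ) + w * s.consensusError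

/-- The conditions on the learning rates and the weight matrix for one step of descent. -/
structure StepCondition (L1 L2 : ℝ≥0) (γ μ0 c l ρ : ℝ) : Prop where
  γ_pos : 0 < γ
  γ_lt : L2 < 1 / (2 * γ)
  l_pos : 0 < l
  c_pos : 0 < c
  ratio : c * ((L2 ^ 2 + 1 / γ ^ 2) / (1 / γ - L2) ^ 2) ≤ 1 / 16
  upper : 16 * smoothConst L1 L2 γ μ0 * (c * l) ≤ 1
  lower : 12 * smoothConst L1 L2 γ μ0 * l ≤ 1
  gossip : 4 * consensusConst L1 L2 γ μ0 c * l ^ 2 ≤ (1 - ρ) ^ 2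

theorem IsProxRegular.potential_nonneg (h : Q.IsProxRegular L2 γ) (hF : ∀ z, Flow ≤ Q.F z)
    (hμ : 0 ≤ μ) (z : Pair dx dy) (θ : Vec dy) : 0 ≤ Q.potential γ μ Flow z θ := by
  have h1 := mul_nonneg hμ (sub_nonneg.2 (hF z))
  have h2 := h.moreau_le_G z
  have h3 := h.moreau_le z θ
  unfold potential
  linarith

theorem IsProxRegular.lyapunov_nonneg (h : Q.IsProxRegular L2 γ) (hF : ∀ z, Flow ≤ Q.F z)
    (hμ : 0 ≤ μ) {w : ℝ} (hw : 0 ≤ w) (s : State n dx dy) : 0 ≤ Q.lyapunov γ μ Flow w s :=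
  add_nonneg (h.potential_nonneg hF hμ _ _) (mul_nonneg hw s.consensusError_nonneg)

theorem potential_mono (hF : ∀ z, Flow ≤ Q.F z) (hμ : μ' ≤ μ) (z : Pair dx dy) (θ : Vec dy) :
    Q.potential γ μ' Flow z θ ≤ Q.potential γ μ Flow z θ := by
  have := mul_le_mul_of_nonneg_right hμ (sub_nonneg.2 (hF z))
  unfold potential
  linarith

/-- One iteration decreases the Lyapunov function, up to noise and dissimilarity. -/
theorem IsSmooth.lyapunov_step_le (hQ : Q.IsSmooth L1 L2) (hn : 0 < n)
    (hF : ∀ z, Flow ≤ Q.F z) {σf σg : ℝ} (hσ : Q.HasBoundedDissimilarity σf σg)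
    (hW : IsWeightMatrix W) (hρ : connectivity W hW.isHermitian < 1)
    (hc : StepCondition L1 L2 γ μ0 c l (connectivity W hW.isHermitian))
    (hμ : 0 ≤ μ) (hμ0 : μ ≤ μ0) (hμ' : μ' ≤ μ)
    (s : State n dx dy) (ξf : Fin n → Ξf) (ξg : Fin n → Ξg) :
    Q.lyapunov γ μ' Flow (2 * biasConst L1 L2 μ0 c * l / (1 - connectivity W hW.isHermitian))
        (Q.step γ μ s W l (c * l) (c * l) ξf ξg)
      ≤ Q.lyapunov γ μ Flow (2 * biasConst L1 L2 μ0 c * l / (1 - connectivity W hW.isHermitian)) s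
        - c * l / 4 * ‖Q.gradPsi γ μ s.mean‖ ^ 2 - Q.linearNoise γ μ c l s ξf ξg
        + noiseConst L1 L2 γ μ0 c * l ^ 2 * (‖avg (Q.errF s ξf)‖ ^ 2 + ‖avg (Q.errG s ξg)‖ ^ 2
          + ‖avg (Q.errH s ξg)‖ ^ 2)
        + 4 * biasConst L1 L2 μ0 c * consensusConst L1 L2 γ μ0 c * l ^ 3
          / (1 - connectivity W hW.isHermitian) ^ 2 * (σf ^ 2 + σg ^ 2 + Q.meanNoise s ξf ξg) := by
  have h1 := hQ.potential_step_le (Flow := Flow) hn hc.γ_pos hc.γ_lt hW hμ hμ0 hc.l_pos hc.c_pos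
    hc.ratio hc.upper hc.lower s ξf ξg
  have h2 := hQ.consensusError_step_le (c := c) (l := l) hc.γ_pos hσ hW hρ hμ hμ0 s ξf ξg
  have h3 := potential_mono hF hμ' (γ := γ) (Q.step γ μ s W l (c * l) (c * l) ξf ξg).mean
    (avg (Q.step γ μ s W l (c * l) (c * l) ξf ξg).θ)
  have hg := hc.gossip
  have hl := hc.l_pos
  have hB := biasConst_nonneg (L1 := L1) (L2 := L2) (μ0 := μ0) hc.c_pos.le
  have hΔ := s.consensusError_nonneg
  set ρ := connectivity W hW.isHermitian
  have hρ1 : 0 < 1 - ρ := sub_pos.2 hρ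
  set B := biasConst L1 L2 μ0 c
  set A := consensusConst L1 L2 γ μ0 c
  set T := σf ^ 2 + σg ^ 2 + Q.meanNoise s ξf ξg with hT
  set Δ := s.consensusError
  have h4 : (Q.step γ μ s W l (c * l) (c * l) ξf ξg).consensusError
      ≤ (1 - (1 - ρ) / 2) * Δ + 2 / (1 - ρ) * l ^ 2 * A * T := by
    have : 2 / (1 - ρ) * l ^ 2 * A * Δ ≤ (1 - ρ) / 2 * Δ := by
      gcongr
      rw [div_mul_eq_mul_div, div_mul_eq_mul_div, div_le_iff₀ hρ1]
      linarith
    have e : 2 / (1 - ρ) * l ^ 2 * (A * (Δ + (σf ^ 2 + σg ^ 2) + Q.meanNoise s ξf ξg))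
        = 2 / (1 - ρ) * l ^ 2 * A * Δ + 2 / (1 - ρ) * l ^ 2 * A * T := by rw [hT]; ring
    linarith
  have h5 : 2 * B * l / (1 - ρ) * (Q.step γ μ s W l (c * l) (c * l) ξf ξg).consensusError
      ≤ 2 * B * l / (1 - ρ) * Δ - l * B * Δ + 4 * B * A * l ^ 3 / (1 - ρ) ^ 2 * T := by
    refine (mul_le_mul_of_nonneg_left h4 (by positivity)).trans_eq ?_
    field_simp
    ring
  unfold lyapunov
  linarith

section Oracle

variable {Ω : Type*} [MeasurableSpace Ω] {P : Measure Ω} [IsProbabilityMeasure P]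

theorem integral_sample_error {E Ξ : Type*} [MeasurableSpace Ξ] [NormedAddCommGroup E]
    [InnerProductSpace ℝ E] [CompleteSpace E] [MeasurableSpace E] [BorelSpace E]
    [SecondCountableTopology E] {ν : Measure Ξ} {φ : Ξ → E} {m : E} {v : ℝ} (hφ : Measurable φ)
    (hmean : ∫ ξ, φ ξ ∂ν = m) (hint : Integrable (fun ξ => ‖m - φ ξ‖ ^ 2) ν)
    (hvar : ∫ ξ, ‖m - φ ξ‖ ^ 2 ∂ν ≤ v) {ξ : Ω → Ξ} (hξ : Measurable ξ) (hlaw : P.map ξ = ν) :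
    Integrable (fun ω => φ (ξ ω) - m) P ∧ ∫ ω, φ (ξ ω) - m ∂P = 0 ∧
      Integrable (fun ω => ‖φ (ξ ω) - m‖ ^ 2) P ∧ ∫ ω, ‖φ (ξ ω) - m‖ ^ 2 ∂P ≤ v := by
  subst hlaw
  have hmeas : Measurable fun ω => φ (ξ ω) - m := (hφ.comp hξ).sub_const m
  have h2 : Integrable (fun ω => ‖φ (ξ ω) - m‖ ^ 2) P := by
    have := hint.comp_measurable hξ
    refine this.congr (Filter.Eventually.of_forall fun ω => ?_)
    simp only [Function.comp, norm_sub_rev]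
  have h1 : Integrable (fun ω => φ (ξ ω) - m) P :=
    ((memLp_two_iff_integrable_sq_norm hmeas.aestronglyMeasurable).2 h2).integrable one_le_two
  refine ⟨h1, ?_, h2, ?_⟩
  · have h3 : Integrable (fun ω => φ (ξ ω)) P := by
      refine (h1.add (integrable_const m)).congr (Filter.Eventually.of_forall fun ω => ?_)
      simp
    rw [integral_sub h3 (integrable_const m), ← hmean,
      integral_map hξ.aemeasurable hφ.aestronglyMeasurable]
    simp
  · have h3 : Measurable fun ξ => ‖m - φ ξ‖ ^ 2 := (hφ.const_sub m).norm.pow_const 2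
    rw [integral_map hξ.aemeasurable h3.aestronglyMeasurable] at hvar
    simpa only [norm_sub_rev] using hvar

theorem exists_linearNoise_eq (s : State n dx dy) :
    ∃ v w : Pair dx dy, ∀ ζf ζg, Q.linearNoise γ μ c l s ζf ζg
      = c * l * μ * inner ℝ v (avg (Q.errF s ζf)) + c * l * inner ℝ v (avg (Q.errG s ζg))
        + inner ℝ w (avg (Q.errH s ζg)) := by
  refine ⟨Q.gradPsi γ μ s.mean
      + (Q.envGrad γ s.mean (avg s.θ) - Q.envGrad γ s.mean (Q.proxPoint γ s.mean)),
    pair 0 (l • Q.proxGrad γ s.mean (avg s.θ)) - (c * l) • dropSnd (Q.gradPsi γ μ s.mean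
      + (Q.envGrad γ s.mean (avg s.θ) - Q.envGrad γ s.mean (Q.proxPoint γ s.mean))),
    fun ζf ζg => ?_⟩
  have h1 : ∀ v u : Pair dx dy, inner ℝ v (dropSnd u) = inner ℝ (dropSnd v) u := fun v u => by
    rw [inner_pair_eq, inner_pair_eq]; simp [dropSnd]
  have h2 : ∀ (g : Vec dy) (u : Pair dx dy), inner ℝ (pair 0 g) u = inner ℝ g u.snd := fun g u => by
    rw [inner_pair_eq]; simp
  unfold linearNoise upperNoise
  rw [inner_sub_right, inner_add_right, inner_sub_left, h1, h2, real_inner_smul_right,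
    real_inner_smul_left, real_inner_smul_left]
  ring

/-- The expected change of the Lyapunov function in one iteration from a fixed state. -/
theorem IsSmooth.lintegral_lyapunov_step_le (hQ : Q.IsSmooth L1 L2) {δf δg : ℝ}
    (hO : Q.IsStochasticOracle δf δg) (hn : 0 < n)
    (hF : ∀ z, Flow ≤ Q.F z) {σf σg : ℝ} (hσ : Q.HasBoundedDissimilarity σf σg)
    (hW : IsWeightMatrix W) (hρ : connectivity W hW.isHermitian < 1)
    (hc : StepCondition L1 L2 γ μ0 c l (connectivity W hW.isHermitian))
    (hμ : 0 ≤ μ) (hμ0 : μ ≤ μ0) (hμ' : μ' ≤ μ) (hμ'0 : 0 ≤ μ')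
    {ξf : Fin n → Ω → Ξf} {ξg : Fin n → Ω → Ξg} (hξf : ∀ i, Measurable (ξf i))
    (hξg : ∀ i, Measurable (ξg i)) (hlawf : ∀ i, P.map (ξf i) = Q.lawF i)
    (hlawg : ∀ i, P.map (ξg i) = Q.lawG i)
    (hind : ∀ i j, i ≠ j →
      IndepFun (fun ω => (ξf i ω, ξg i ω)) (fun ω => (ξf j ω, ξg j ω)) P)
    (s : State n dx dy) :
    ∫⁻ ω, ENNReal.ofReal (Q.lyapunov γ μ' Flow
          (2 * biasConst L1 L2 μ0 c * l / (1 - connectivity W hW.isHermitian))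
          (Q.step γ μ s W l (c * l) (c * l) (fun i => ξf i ω) fun i => ξg i ω)) ∂P
        + ENNReal.ofReal (c * l / 4 * ‖Q.gradPsi γ μ s.mean‖ ^ 2)
      ≤ ENNReal.ofReal (Q.lyapunov γ μ Flow
          (2 * biasConst L1 L2 μ0 c * l / (1 - connectivity W hW.isHermitian)) s)
        + ENNReal.ofReal (noiseConst L1 L2 γ μ0 c * l ^ 2 * ((δf ^ 2 + 2 * δg ^ 2) / n)
          + 4 * biasConst L1 L2 μ0 c * consensusConst L1 L2 γ μ0 c * l ^ 3
            / (1 - connectivity W hW.isHermitian) ^ 2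
              * (σf ^ 2 + σg ^ 2 + (δf ^ 2 + 2 * δg ^ 2))) := by
  have hreg := hQ.isProxRegular hn hc.γ_pos hc.γ_lt
  have hmF : ∀ i z, Measurable fun ξ => Q.gradF i z ξ := fun i z =>
    (hO.measurable_f i).comp (measurable_const.prodMk measurable_id)
  have hmG : ∀ i z, Measurable fun ξ => Q.gradG i z ξ := fun i z =>
    (hO.measurable_g i).comp (measurable_const.prodMk measurable_id)
  have eF := fun i => integral_sample_error (P := P) (hmF i (pair (s.x i) (s.y i)))
    (hO.unbiased_f i _) (hO.integrable_variance_f i _) (hO.variance_f i _) (hξf i) (hlawf i)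
  have eG := fun i => integral_sample_error (P := P) (hmG i (pair (s.x i) (s.y i)))
    (hO.unbiased_g i _) (hO.integrable_variance_g i _) (hO.variance_g i _) (hξg i) (hlawg i)
  have eH := fun i => integral_sample_error (P := P) (hmG i (pair (s.x i) (s.θ i)))
    (hO.unbiased_g i _) (hO.integrable_variance_g i _) (hO.variance_g i _) (hξg i) (hlawg i)
  obtain ⟨f1, f2, f3, f4⟩ := integral_norm_avg_sq_le hn (fun i => (eF i).1) (fun i => (eF i).2.1)
    (fun i => (eF i).2.2.1) (fun i => (eF i).2.2.2) fun i j hij =>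
      (hind i j hij).comp (((hmF i _).comp measurable_fst).sub_const _)
        (((hmF j _).comp measurable_fst).sub_const _)
  obtain ⟨g1, g2, g3, g4⟩ := integral_norm_avg_sq_le hn (fun i => (eG i).1) (fun i => (eG i).2.1)
    (fun i => (eG i).2.2.1) (fun i => (eG i).2.2.2) fun i j hij =>
      (hind i j hij).comp (((hmG i _).comp measurable_snd).sub_const _)
        (((hmG j _).comp measurable_snd).sub_const _)
  obtain ⟨h1, h2, h3, h4⟩ := integral_norm_avg_sq_le hn (fun i => (eH i).1) (fun i => (eH i).2.1)
    (fun i => (eH i).2.2.1) (fun i => (eH i).2.2.2) fun i j hij =>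
      (hind i j hij).comp (((hmG i _).comp measurable_snd).sub_const _)
        (((hmG j _).comp measurable_snd).sub_const _)
  replace f1 : Integrable (fun ω => avg (Q.errF s fun i => ξf i ω)) P := f1
  replace f2 : ∫ ω, avg (Q.errF s fun i => ξf i ω) ∂P = 0 := f2
  replace f3 : Integrable (fun ω => ‖avg (Q.errF s fun i => ξf i ω)‖ ^ 2) P := f3
  replace f4 : ∫ ω, ‖avg (Q.errF s fun i => ξf i ω)‖ ^ 2 ∂P ≤ δf ^ 2 / n := f4
  replace g1 : Integrable (fun ω => avg (Q.errG s fun i => ξg i ω)) P := g1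
  replace g2 : ∫ ω, avg (Q.errG s fun i => ξg i ω) ∂P = 0 := g2
  replace g3 : Integrable (fun ω => ‖avg (Q.errG s fun i => ξg i ω)‖ ^ 2) P := g3
  replace g4 : ∫ ω, ‖avg (Q.errG s fun i => ξg i ω)‖ ^ 2 ∂P ≤ δg ^ 2 / n := g4
  replace h1 : Integrable (fun ω => avg (Q.errH s fun i => ξg i ω)) P := h1
  replace h2 : ∫ ω, avg (Q.errH s fun i => ξg i ω) ∂P = 0 := h2
  replace h3 : Integrable (fun ω => ‖avg (Q.errH s fun i => ξg i ω)‖ ^ 2) P := h3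
  replace h4 : ∫ ω, ‖avg (Q.errH s fun i => ξg i ω)‖ ^ 2 ∂P ≤ δg ^ 2 / n := h4
  have m := fun i => integrable_add_three (eF i).2.2.1 (eG i).2.2.1 (eH i).2.2.1 (eF i).2.2.2
    (eG i).2.2.2 (eH i).2.2.2
  have nI : Integrable (fun ω => Q.meanNoise s (fun i => ξf i ω) fun i => ξg i ω) P := by
    unfold meanNoise avg
    exact (integrable_finsetSum Finset.univ fun i _ => (m i).1).smul (n : ℝ)⁻¹
  have nV : ∫ ω, Q.meanNoise s (fun i => ξf i ω) (fun i => ξg i ω) ∂P ≤ δf ^ 2 + δg ^ 2 + δg ^ 2 :=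
    integral_avg_le hn (fun i => (m i).1) fun i => (m i).2
  obtain ⟨v, w, hvw⟩ := Q.exists_linearNoise_eq (γ := γ) (μ := μ) (c := c) (l := l) s
  obtain ⟨a1, a2⟩ := integrable_const_inner_of_integral_eq_zero f1 f2 v
  obtain ⟨b1, b2⟩ := integrable_const_inner_of_integral_eq_zero g1 g2 v
  obtain ⟨d1, d2⟩ := integrable_const_inner_of_integral_eq_zero h1 h2 w
  have lI : Integrable (fun ω => Q.linearNoise γ μ c l s (fun i => ξf i ω) fun i => ξg i ω) P := by
    simp only [hvw]
    exact ((a1.const_mul _).add (b1.const_mul _)).add d1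
  have lV : ∫ ω, Q.linearNoise γ μ c l s (fun i => ξf i ω) (fun i => ξg i ω) ∂P = 0 := by
    have ab : Integrable (fun ω => c * l * μ * inner ℝ v (avg (Q.errF s fun i => ξf i ω))
        + c * l * inner ℝ v (avg (Q.errG s fun i => ξg i ω))) P :=
      (a1.const_mul _).add (b1.const_mul _)
    simp only [hvw]
    rw [integral_add ab d1, integral_add (a1.const_mul _) (b1.const_mul _), integral_const_mul,
      integral_const_mul, a2, b2, d2]
    simp
  obtain ⟨sI, sV⟩ := integrable_add_three f3 g3 h3 f4 g4 h4
  have hstep := fun ω => hQ.lyapunov_step_le hn hF hσ hW hρ hc hμ hμ0 hμ' s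
    (fun i => ξf i ω) fun i => ξg i ω
  have hl := hc.l_pos
  have hB := biasConst_nonneg (L1 := L1) (L2 := L2) (μ0 := μ0) hc.c_pos.le
  have hN := noiseConst_pos (L1 := L1) (L2 := L2) (c := c) hc.γ_pos (hμ.trans hμ0)
  have hA := consensusConst_nonneg (L1 := L1) (L2 := L2) (γ := γ) (μ0 := μ0) (c := c)
  set ρ := connectivity W hW.isHermitian
  have hρ1 : 0 < 1 - ρ := sub_pos.2 hρ
  set B := biasConst L1 L2 μ0 c
  set A := consensusConst L1 L2 γ μ0 c
  set N := noiseConst L1 L2 γ μ0 c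
  set k1 := N * l ^ 2
  set k2 := 4 * B * A * l ^ 3 / (1 - ρ) ^ 2
  have hk1 : 0 ≤ k1 := by positivity
  have hk2 : 0 ≤ k2 := by positivity
  set a := Q.lyapunov γ μ Flow (2 * B * l / (1 - ρ)) s - c * l / 4 * ‖Q.gradPsi γ μ s.mean‖ ^ 2
  have hnonneg : ∀ t : State n dx dy, ∀ ν : ℝ, 0 ≤ ν →
      0 ≤ Q.lyapunov γ ν Flow (2 * B * l / (1 - ρ)) t :=
    fun t ν hν => hreg.lyapunov_nonneg hF hν (by positivity) t
  obtain ⟨r0, r1⟩ := lintegral_ofReal_le_of_le_affine (fun ω => hnonneg _ _ hμ'0) hstep hk1 hk2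
    lI lV sI sV nI nV
  refine (add_le_add_left r1 _).trans_eq ?_
  rw [← ENNReal.ofReal_add r0 (by have := hc.c_pos; positivity),
    ← ENNReal.ofReal_add (hnonneg s μ hμ) (by positivity)]
  congr 1
  simp only [a]
  ring

end Oracle

end Problem

namespace State

variable {n dx dy : ℕ}

instance : MeasurableSpace (State n dx dy) :=
  MeasurableSpace.comap (fun s => (s.θ, s.x, s.y)) inferInstance

theorem measurable_toProd :
    Measurable fun s : State n dx dy => (s.θ, s.x, s.y) := comap_measurable _

theorem measurable_θ (i : Fin n) : Measurable fun s : State n dx dy => s.θ i :=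
  (measurable_pi_apply i).comp (measurable_fst.comp measurable_toProd)

theorem measurable_x (i : Fin n) : Measurable fun s : State n dx dy => s.x i :=
  (measurable_pi_apply i).comp (measurable_fst.comp (measurable_snd.comp measurable_toProd))

theorem measurable_y (i : Fin n) : Measurable fun s : State n dx dy => s.y i :=
  (measurable_pi_apply i).comp (measurable_snd.comp (measurable_snd.comp measurable_toProd))

theorem measurable_of_components {α : Type*} [MeasurableSpace α] {f : α → State n dx dy}
    (hθ : ∀ i, Measurable fun a => (f a).θ i) (hx : ∀ i, Measurable fun a => (f a).x i)
    (hy : ∀ i, Measurable fun a => (f a).y i) : Measurable f :=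
  measurable_comap_iff.2 ((measurable_pi_lambda _ hθ).prodMk
    ((measurable_pi_lambda _ hx).prodMk (measurable_pi_lambda _ hy)))

end State

section Measurability

variable {n dx dy : ℕ} {α : Type*} [MeasurableSpace α]

theorem measurable_pair {f : α → Vec dx} {g : α → Vec dy} (hf : Measurable f)
    (hg : Measurable g) : Measurable fun a => pair (f a) (g a) :=
  continuous_pair.measurable.comp (hf.prodMk hg)

theorem measurable_fst_vec : Measurable fun z : Pair dx dy => z.fst :=
  (WithLp.fstL 2 ℝ (Vec dx) (Vec dy)).continuous.measurable

theorem measurable_snd_vec : Measurable fun z : Pair dx dy => z.snd :=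
  (WithLp.sndL 2 ℝ (Vec dx) (Vec dy)).continuous.measurable

theorem measurable_avg {E : Type*} [NormedAddCommGroup E] [InnerProductSpace ℝ E]
    [MeasurableSpace E] [BorelSpace E] [SecondCountableTopology E] {f : Fin n → α → E}
    (hf : ∀ i, Measurable (f i)) : Measurable fun a => avg fun i => f i a := by
  unfold avg
  exact (Finset.measurable_fun_sum _ fun i _ => hf i).const_smul _

theorem State.measurable_avg_θ : Measurable fun s : State n dx dy => avg s.θ :=
  measurable_avg State.measurable_θ

theorem State.measurable_mean : Measurable (State.mean : State n dx dy → _) :=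
  measurable_pair (measurable_avg State.measurable_x) (measurable_avg State.measurable_y)

theorem State.measurable_consensusError :
    Measurable (State.consensusError : State n dx dy → ℝ) :=
  measurable_avg fun i =>
    ((((State.measurable_x i).sub (measurable_avg State.measurable_x)).norm.pow_const 2).add
      (((State.measurable_y i).sub (measurable_avg State.measurable_y)).norm.pow_const 2)).add
      (((State.measurable_θ i).sub (measurable_avg State.measurable_θ)).norm.pow_const 2)

end Measurability

namespace Problem

variable {n dx dy : ℕ} {Ξf Ξg : Type*} [MeasurableSpace Ξf] [MeasurableSpace Ξg]
variable {Q : Problem n dx dy Ξf Ξg} {L1 L2 : ℝ≥0} {γ μ μ0 Flow c l : ℝ}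
variable {W : Matrix (Fin n) (Fin n) ℝ}

theorem IsStochasticOracle.measurable_step {δf δg : ℝ} (hO : Q.IsStochasticOracle δf δg)
    (lθ lx ly : ℝ) {α : Type*} [MeasurableSpace α] {s : α → State n dx dy} {ζf : Fin n → α → Ξf}
    {ζg : Fin n → α → Ξg} (hs : Measurable s) (hf : ∀ i, Measurable (ζf i))
    (hg : ∀ i, Measurable (ζg i)) :
    Measurable fun a => Q.step γ μ (s a) W lθ lx ly (fun i => ζf i a) fun i => ζg i a := by
  have mθ := fun i => (State.measurable_θ i).comp hs
  have mx := fun i => (State.measurable_x i).comp hs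
  have my := fun i => (State.measurable_y i).comp hs
  have mF := fun i => (hO.measurable_f i).comp ((measurable_pair (mx i) (my i)).prodMk (hf i))
  have mG := fun i => (hO.measurable_g i).comp ((measurable_pair (mx i) (my i)).prodMk (hg i))
  have mH := fun i => (hO.measurable_g i).comp ((measurable_pair (mx i) (mθ i)).prodMk (hg i))
  refine State.measurable_of_components (fun i => ?_) (fun i => ?_) fun i => ?_
  · simp only [step]
    refine Finset.measurable_fun_sum Finset.univ fun j _ => ?_
    exact ((mθ j).sub (((measurable_snd_vec.comp (mH j)).add
      (((mθ j).sub (my j)).const_smul (1 / γ))).const_smul lθ)).const_smul (W i j)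
  · simp only [step]
    refine Finset.measurable_fun_sum Finset.univ fun j _ => ?_
    exact ((mx j).sub
      (((((measurable_fst_vec.comp (mF j)).const_smul μ).add (measurable_fst_vec.comp (mG j))).sub
        (measurable_fst_vec.comp (mH j))).const_smul lx)).const_smul (W i j)
  · simp only [step]
    refine Finset.measurable_fun_sum Finset.univ fun j _ => ?_
    exact ((my j).sub
      (((((measurable_snd_vec.comp (mF j)).const_smul μ).add (measurable_snd_vec.comp (mG j))).sub
        (((my j).sub (mθ j)).const_smul (1 / γ))).const_smul ly)).const_smul (W i j)

theorem IsStochasticOracle.measurable_sunDsboSE {δf δg : ℝ} (hO : Q.IsStochasticOracle δf δg)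
    (μ lθ lx ly : ℕ → ℝ) (s0 : State n dx dy) {α : Type*} [MeasurableSpace α]
    {ζf : Fin n → ℕ → α → Ξf} {ζg : Fin n → ℕ → α → Ξg} :
    ∀ k : ℕ, (∀ i, ∀ j < k, Measurable (ζf i j)) → (∀ i, ∀ j < k, Measurable (ζg i j)) →
      Measurable fun a => Q.sunDsboSE γ W μ lθ lx ly s0 (fun i j => ζf i j a)
        (fun i j => ζg i j a) k
  | 0, _, _ => measurable_const
  | k + 1, hf, hg => hO.measurable_step _ _ _
      (measurable_sunDsboSE hO μ lθ lx ly s0 k (fun i j hj => hf i j (hj.trans k.lt_succ_self))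
        fun i j hj => hg i j (hj.trans k.lt_succ_self))
      (fun i => hf i k k.lt_succ_self) fun i => hg i k k.lt_succ_self

/-- The iterate `k` is independent of the samples drawn at iteration `k`. -/
theorem IsStochasticOracle.indepFun_sunDsboSE {δf δg : ℝ} (hO : Q.IsStochasticOracle δf δg)
    (μ lθ lx ly : ℕ → ℝ) (s0 : State n dx dy) {Ω : Type*} [mΩ : MeasurableSpace Ω] {P : Measure Ω}
    {ξf : Fin n → ℕ → Ω → Ξf} {ξg : Fin n → ℕ → Ω → Ξg} (hS : Q.IsSampling P ξf ξg) (k : ℕ) :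
    IndepFun (fun ω => Q.sunDsboSE γ W μ lθ lx ly s0 (fun i j => ξf i j ω) (fun i j => ξg i j ω) k)
      (fun ω i => (ξf i k ω, ξg i k ω)) P := by
  set m : Fin n × ℕ → MeasurableSpace Ω := fun p =>
    MeasurableSpace.comap (fun ω => (ξf p.1 p.2 ω, ξg p.1 p.2 ω)) inferInstance with hm
  have hle : ∀ p, m p ≤ mΩ := fun p =>
    ((hS.measurable_f p.1 p.2).prodMk (hS.measurable_g p.1 p.2)).comap_le
  have hdisj : Disjoint {p : Fin n × ℕ | p.2 < k} {p | p.2 = k} :=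
    Set.disjoint_left.2 fun p h1 h2 => by
      simp only [Set.mem_ofPred_eq] at h1 h2; omega
  have hI := indep_iSup_of_disjoint hle hS.indep.iIndep hdisj
  have hpair : ∀ (S : Set (Fin n × ℕ)) (p : Fin n × ℕ), p ∈ S →
      Measurable[⨆ q ∈ S, m q] fun ω => (ξf p.1 p.2 ω, ξg p.1 p.2 ω) := fun S p hp =>
    (comap_measurable _).mono (le_iSup₂_of_le p hp le_rfl) le_rfl
  refine indep_of_indep_of_le_left (indep_of_indep_of_le_right hI ?_) ?_
  · refine Measurable.comap_le ?_
    refine @measurable_pi_lambda _ _ _ (_) _ _ fun i => ?_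
    exact hpair _ (i, k) rfl
  · refine Measurable.comap_le ?_
    refine @measurable_sunDsboSE _ _ _ _ _ _ _ _ _ _ _ _ hO μ lθ lx ly s0 _ (_) _ _ k ?_ ?_
    · intro i j hj
      exact measurable_fst.comp (hpair {p | p.2 < k} (i, j) hj)
    · intro i j hj
      exact measurable_snd.comp (hpair {p | p.2 < k} (i, j) hj)

theorem lintegral_indepFun_eq {Ω α β : Type*} [MeasurableSpace Ω] [MeasurableSpace α]
    [MeasurableSpace β] {P : Measure Ω} [IsProbabilityMeasure P] {X : Ω → α} {Y : Ω → β}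
    (hX : Measurable X) (hY : Measurable Y) (h : IndepFun X Y P) {φ : α × β → ENNReal}
    (hφ : Measurable φ) :
    ∫⁻ ω, φ (X ω, Y ω) ∂P = ∫⁻ ω, ∫⁻ ω', φ (X ω, Y ω') ∂P ∂P := by
  have := Measure.isProbabilityMeasure_map (μ := P) hY.aemeasurable
  rw [← lintegral_map (μ := P) hφ (hX.prodMk hY),
    h.map_prod_eq_prod_map_map hX.aemeasurable hY.aemeasurable,
    lintegral_prod _ hφ.aemeasurable, lintegral_map hφ.lintegral_prod_right' hX]
  refine lintegral_congr fun ω => ?_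
  exact lintegral_map (hφ.comp measurable_prodMk_left) hY

theorem IsProxRegular.continuous_gradPsi (h : Q.IsProxRegular L2 γ)
    (hL : LipschitzWith L1 (∇ Q.F)) : Continuous (Q.gradPsi γ μ) := by
  have h1 : Continuous fun z : Pair dx dy => pair z.fst (Q.proxPoint γ z) :=
    continuous_pair.comp ((WithLp.fstL 2 ℝ (Vec dx) (Vec dy)).continuous.prodMk
      h.continuous_proxPoint)
  have h2 : Continuous fun z : Pair dx dy => (∇ Q.G (pair z.fst (Q.proxPoint γ z))).fst :=
    (WithLp.fstL 2 ℝ (Vec dx) (Vec dy)).continuous.comp (h.lipschitz.continuous.comp h1)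
  have h3 : Continuous fun z : Pair dx dy => (1 / γ) • (z.snd - Q.proxPoint γ z) :=
    (((WithLp.sndL 2 ℝ (Vec dx) (Vec dy)).continuous.sub h.continuous_proxPoint)).const_smul (1 / γ)
  exact ((hL.continuous.const_smul μ).add h.lipschitz.continuous).sub
    (continuous_pair.comp (h2.prodMk h3))

theorem IsProxRegular.measurable_lyapunov (h : Q.IsProxRegular L2 γ) (hF : Differentiable ℝ Q.F)
    (w : ℝ) : Measurable (Q.lyapunov γ μ Flow w) := by
  have m1 := (continuous_of_differentiable hF).measurable.comp (State.measurable_mean (n := n))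
  have m2 := (continuous_of_differentiable h.differentiable).measurable.comp
    (State.measurable_mean (n := n))
  have m3 := (continuous_of_differentiable
    (differentiable_of_hasGradientAt h.hasGradientAt_moreau)).measurable.comp
    (State.measurable_mean (n := n))
  have m4 := (continuous_proxObjective (γ := γ) h.differentiable).measurable.comp
    ((State.measurable_mean (n := n)).prodMk State.measurable_avg_θ)
  exact ((((m1.sub_const Flow).const_mul μ).add (m2.sub m3)).add (m4.sub m3)).add
    (State.measurable_consensusError.const_mul w)

/-- The accumulated expected decrease of the Lyapunov function along the iterates. -/
theorem IsSmooth.lintegral_lyapunov_add_sum_le (hQ : Q.IsSmooth L1 L2) {δf δg : ℝ}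
    (hO : Q.IsStochasticOracle δf δg) (hn : 0 < n)
    (hF : ∀ z, Flow ≤ Q.F z) {σf σg : ℝ} (hσ : Q.HasBoundedDissimilarity σf σg)
    (hW : IsWeightMatrix W) (hρ : connectivity W hW.isHermitian < 1)
    (hc : StepCondition L1 L2 γ μ0 c l (connectivity W hW.isHermitian)) {μ : ℕ → ℝ}
    (hμ : ∀ k, 0 ≤ μ k) (hμanti : Antitone μ) (hμ0 : μ 0 ≤ μ0)
    {Ω : Type*} [MeasurableSpace Ω] {P : Measure Ω} [IsProbabilityMeasure P]
    {ξf : Fin n → ℕ → Ω → Ξf} {ξg : Fin n → ℕ → Ω → Ξg} (hS : Q.IsSampling P ξf ξg)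
    (s0 : State n dx dy) (K : ℕ) :
    ∫⁻ ω, ENNReal.ofReal (Q.lyapunov γ (μ K) Flow
          (2 * biasConst L1 L2 μ0 c * l / (1 - connectivity W hW.isHermitian))
          (Q.sunDsboSE γ W μ (fun _ => l) (fun _ => c * l) (fun _ => c * l) s0
            (fun i j => ξf i j ω) (fun i j => ξg i j ω) K)) ∂P
        + ∑ k ∈ Finset.range K, ∫⁻ ω, ENNReal.ofReal (c * l / 4 * ‖Q.gradPsi γ (μ k)
          (Q.sunDsboSE γ W μ (fun _ => l) (fun _ => c * l) (fun _ => c * l) s0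
            (fun i j => ξf i j ω) (fun i j => ξg i j ω) k).mean‖ ^ 2) ∂P
      ≤ ENNReal.ofReal (Q.lyapunov γ (μ 0) Flow
          (2 * biasConst L1 L2 μ0 c * l / (1 - connectivity W hW.isHermitian)) s0)
        + K * ENNReal.ofReal (noiseConst L1 L2 γ μ0 c * l ^ 2 * ((δf ^ 2 + 2 * δg ^ 2) / n)
          + 4 * biasConst L1 L2 μ0 c * consensusConst L1 L2 γ μ0 c * l ^ 3
            / (1 - connectivity W hW.isHermitian) ^ 2
              * (σf ^ 2 + σg ^ 2 + (δf ^ 2 + 2 * δg ^ 2))) := by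
  have hreg := hQ.isProxRegular hn hc.γ_pos hc.γ_lt
  set R := ENNReal.ofReal (noiseConst L1 L2 γ μ0 c * l ^ 2 * ((δf ^ 2 + 2 * δg ^ 2) / n)
          + 4 * biasConst L1 L2 μ0 c * consensusConst L1 L2 γ μ0 c * l ^ 3
            / (1 - connectivity W hW.isHermitian) ^ 2
              * (σf ^ 2 + σg ^ 2 + (δf ^ 2 + 2 * δg ^ 2)))
  set w := 2 * biasConst L1 L2 μ0 c * l / (1 - connectivity W hW.isHermitian)
  induction K with
  | zero => simp [sunDsboSE]
  | succ K ih =>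
    set s : Ω → State n dx dy := fun ω => Q.sunDsboSE γ W μ (fun _ => l) (fun _ => c * l)
      (fun _ => c * l) s0 (fun i j => ξf i j ω) (fun i j => ξg i j ω) K
    have hs : Measurable s := hO.measurable_sunDsboSE μ _ _ _ s0 K
      (fun i j _ => hS.measurable_f i j) fun i j _ => hS.measurable_g i j
    have hζ : Measurable fun ω i => (ξf i K ω, ξg i K ω) :=
      measurable_pi_lambda _ fun i => (hS.measurable_f i K).prodMk (hS.measurable_g i K)
    have hind := hO.indepFun_sunDsboSE (γ := γ) (W := W) μ (fun _ => l) (fun _ => c * l)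
      (fun _ => c * l) s0 hS K
    have hφ : Measurable fun q : State n dx dy × (Fin n → Ξf × Ξg) =>
        ENNReal.ofReal (Q.lyapunov γ (μ (K + 1)) Flow w (Q.step γ (μ K) q.1 W l (c * l) (c * l)
          (fun i => (q.2 i).1) fun i => (q.2 i).2)) :=
      ((hreg.measurable_lyapunov hQ.differentiable_F w).comp (hO.measurable_step l (c * l) (c * l)
        measurable_fst (fun i => measurable_fst.comp ((measurable_pi_apply i).comp measurable_snd))
        fun i => measurable_snd.comp ((measurable_pi_apply i).comp measurable_snd))).ennreal_ofReal
    have hg : Measurable fun ω => ENNReal.ofReal (c * l / 4 * ‖Q.gradPsi γ (μ K) (s ω).mean‖ ^ 2) :=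
      ((((hreg.continuous_gradPsi (hQ.lipschitz_F hn)).measurable.comp
        (State.measurable_mean.comp hs)).norm.pow_const 2).const_mul _).ennreal_ofReal
    have hone : ∫⁻ ω, ENNReal.ofReal (Q.lyapunov γ (μ (K + 1)) Flow w
          (Q.sunDsboSE γ W μ (fun _ => l) (fun _ => c * l) (fun _ => c * l) s0
            (fun i j => ξf i j ω) (fun i j => ξg i j ω) (K + 1))) ∂P
        + ∫⁻ ω, ENNReal.ofReal (c * l / 4 * ‖Q.gradPsi γ (μ K) (s ω).mean‖ ^ 2) ∂P
        ≤ ∫⁻ ω, ENNReal.ofReal (Q.lyapunov γ (μ K) Flow w (s ω)) ∂P + R := by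
      have e := lintegral_indepFun_eq hs hζ hind hφ
      refine (congrArg (· + _) e).trans_le ?_
      rw [← lintegral_add_right _ hg]
      calc _ ≤ ∫⁻ ω, (ENNReal.ofReal (Q.lyapunov γ (μ K) Flow w (s ω)) + R) ∂P := by
            refine lintegral_mono fun ω => ?_
            exact hQ.lintegral_lyapunov_step_le hO hn hF hσ hW hρ hc (hμ K)
              ((hμanti K.zero_le).trans hμ0) (hμanti K.le_succ) (hμ _)
              (fun i => hS.measurable_f i K) (fun i => hS.measurable_g i K)
              (fun i => hS.law_f i K) (fun i => hS.law_g i K)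
              (fun i j hij => hS.indep.indepFun (i := (i, K)) (j := (j, K)) fun h =>
                hij (congrArg Prod.fst h)) (s ω)
        _ = _ := by
            rw [lintegral_add_right _ measurable_const, lintegral_const, measure_univ, mul_one]
    rw [Finset.sum_range_succ, Nat.cast_succ, add_mul, one_mul, ← add_assoc (ENNReal.ofReal _)]
    refine le_trans ?_ (add_le_add_left ih R)
    calc _ = _ + ∑ k ∈ Finset.range K, _ := by rw [add_left_comm, add_comm]
      _ ≤ _ := add_le_add_left hone _
      _ = _ := by rw [add_assoc, add_comm R, ← add_assoc]

end Problem

/-- Conversion of an accumulated decrease into a rate for the learning rate `cθ √n / √K`. -/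
theorem rate_of_accumulated_decrease {c cθ l a b r E N H D S δ σ V : ℝ} (hc : 0 < c) (hcθ : 0 < cθ)
    (ha : 0 < a) (hb : 0 < b) (hr : 0 < r) (hE : 0 ≤ E) (hN : 0 ≤ N) (hH : 0 ≤ H) (hD : 0 ≤ D)
    (hδ : 0 ≤ δ) (hσ : 0 ≤ σ) (hV : V ≤ 2 * δ) (hl : l = cθ * a / b)
    (h : c * l / 4 * S ≤ E * D
      + b ^ 2 * (N * l ^ 2 * (V / a ^ 2) + H * l ^ 3 / r ^ 2 * (σ + V))) :
    1 / b ^ 2 * S ≤ (4 * E / (c * cθ) + 8 * N * cθ / c + 8 * H * cθ ^ 2 / c)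
      * ((D + δ) / (a * b) + a ^ 2 * δ / (r ^ 2 * b ^ 2) + a ^ 2 * σ / (r ^ 2 * b ^ 2)) := by
  have hl0 : 0 < l := by rw [hl]; positivity
  have h1 : c * l / 4 * S ≤ E * D
      + b ^ 2 * (N * l ^ 2 * (2 * δ / a ^ 2) + H * l ^ 3 / r ^ 2 * (σ + 2 * δ)) := by
    refine h.trans ?_; gcongr
  have h2 : S ≤ (E * D + b ^ 2 * (N * l ^ 2 * (2 * δ / a ^ 2)
      + H * l ^ 3 / r ^ 2 * (σ + 2 * δ))) / (c * l / 4) := by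
    rw [le_div_iff₀ (by positivity), mul_comm]; exact h1
  have e : 1 / b ^ 2 * ((E * D + b ^ 2 * (N * l ^ 2 * (2 * δ / a ^ 2)
      + H * l ^ 3 / r ^ 2 * (σ + 2 * δ))) / (c * l / 4))
      = 4 * E / (c * cθ) * (D / (a * b)) + 8 * N * cθ / c * (δ / (a * b))
        + 8 * H * cθ ^ 2 / c * (a ^ 2 * δ / (r ^ 2 * b ^ 2))
        + 4 * H * cθ ^ 2 / c * (a ^ 2 * σ / (r ^ 2 * b ^ 2)) := by
    rw [hl]; field_simp; ring
  refine (mul_le_mul_of_nonneg_left h2 (by positivity)).trans ?_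
  rw [e, add_div]
  have k1 : 0 ≤ 4 * E / (c * cθ) := by positivity
  have k2 : 0 ≤ 8 * N * cθ / c := by positivity
  have k3 : 0 ≤ 4 * H * cθ ^ 2 / c := by positivity
  have k4 : 8 * H * cθ ^ 2 / c = 2 * (4 * H * cθ ^ 2 / c) := by ring
  rw [k4]
  generalize 4 * E / (c * cθ) = A at *
  generalize 8 * N * cθ / c = B at *
  generalize 4 * H * cθ ^ 2 / c = G at *
  have t1 : 0 ≤ D / (a * b) := by positivity
  have t2 : 0 ≤ δ / (a * b) := by positivity
  have t3 : 0 ≤ a ^ 2 * δ / (r ^ 2 * b ^ 2) := by positivity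
  have t4 : 0 ≤ a ^ 2 * σ / (r ^ 2 * b ^ 2) := by positivity
  generalize D / (a * b) = T1 at *
  generalize δ / (a * b) = T2 at *
  generalize a ^ 2 * δ / (r ^ 2 * b ^ 2) = T3 at *
  generalize a ^ 2 * σ / (r ^ 2 * b ^ 2) = T4 at *
  have p1 : 0 ≤ A * (T2 + T3 + T4) := by positivity
  have p2 : 0 ≤ B * (T1 + T3 + T4) := by positivity
  have p3 : 0 ≤ G * (T1 + T2 + T4) := by positivity
  have p4 : 0 ≤ G * (T1 + T2) := by positivity
  linarith

/-- The threshold for the learning rate. -/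
def rateThreshold (L1 L2 : ℝ≥0) (γ μ0 c : ℝ) : ℝ :=
  1 / (16 * smoothConst L1 L2 γ μ0 * c + 12 * smoothConst L1 L2 γ μ0
    + 2 * consensusConst L1 L2 γ μ0 c + 1)

theorem mul_ratio_le_of_le {L2 : ℝ≥0} (hL2 : 0 < L2) {γ c : ℝ} (hγ : 0 < γ)
    (hgap : 0 < 1 / γ - L2) (h : c ≤ (1 / γ - L2) / (32 * a1 L2 γ * Lθ L2 γ ^ 2)) :
    c * ((L2 ^ 2 + 1 / γ ^ 2) / (1 / γ - L2) ^ 2) ≤ 1 / 16 := by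
  have hS : 0 < (L2 : ℝ) ^ 2 + 1 / γ ^ 2 := by positivity
  have hs : 0 < √((L2 : ℝ) ^ 2 + 1 / γ ^ 2) := Real.sqrt_pos.2 hS
  have hss : (L2 : ℝ) ^ 2 + 1 / γ ^ 2 = √((L2 : ℝ) ^ 2 + 1 / γ ^ 2) ^ 2 :=
    (Real.sq_sqrt hS.le).symm
  have e : (1 / γ - L2) / (32 * a1 L2 γ * Lθ L2 γ ^ 2)
      = (1 / γ - L2) ^ 2 / (16 * ((L2 : ℝ) ^ 2 + 1 / γ ^ 2)) := by
    unfold a1 Lθ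
    set η := 1 / γ - (L2 : ℝ)
    set S := √((L2 : ℝ) ^ 2 + 1 / γ ^ 2)
    rw [hss]
    field_simp
    norm_num
  rw [e] at h
  calc _ ≤ (1 / γ - L2) ^ 2 / (16 * ((L2 : ℝ) ^ 2 + 1 / γ ^ 2))
        * ((L2 ^ 2 + 1 / γ ^ 2) / (1 / γ - L2) ^ 2) := by gcongr
    _ = 1 / 16 := by
      generalize 1 / γ - (L2 : ℝ) = η at hgap
      field_simp

theorem stepCondition_of_le_rateThreshold {L1 L2 : ℝ≥0} (hL2 : 0 < L2) {γ μ0 c l ρ : ℝ}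
    (hγ : γ ∈ Set.Ioo (0 : ℝ) (1 / (2 * (L2 : ℝ)))) (hμ0 : 0 < μ0) (hc : 0 < c)
    (hc' : c ≤ (1 / γ - L2) / (32 * a1 L2 γ * Lθ L2 γ ^ 2)) (hl : 0 < l) (hρ : 0 ≤ ρ) (hρ1 : ρ < 1)
    (h : l ≤ rateThreshold L1 L2 γ μ0 c * (1 - ρ)) : Problem.StepCondition L1 L2 γ μ0 c l ρ := by
  have hL2' : (0 : ℝ) < L2 := hL2
  have hγ0 := hγ.1
  have hlt : (L2 : ℝ) < 1 / (2 * γ) := by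
    have := hγ.2
    rw [lt_div_iff₀ (by positivity)] at this ⊢
    linarith
  have hgap : 0 < 1 / γ - L2 := by
    have : 1 / γ = 2 * (1 / (2 * γ)) := by field_simp
    linarith
  have hM := smoothConst_pos (L1 := L1) (L2 := L2) hγ0 hμ0.le
  have hA := consensusConst_nonneg (L1 := L1) (L2 := L2) (γ := γ) (μ0 := μ0) (c := c)
  unfold rateThreshold at h
  set M := smoothConst L1 L2 γ μ0
  set A := consensusConst L1 L2 γ μ0 c
  have hT : 0 < 16 * M * c + 12 * M + 2 * A + 1 := by positivity
  have hr : 0 < 1 - ρ := sub_pos.2 hρ1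
  have hTl : (16 * M * c + 12 * M + 2 * A + 1) * l ≤ 1 - ρ := by
    rw [one_div_mul_eq_div, le_div_iff₀ hT] at h
    linarith
  have q1 : 0 ≤ M * c * l := by positivity
  have q2 : 0 ≤ M * l := by positivity
  have q3 : 0 ≤ A * l := by positivity
  refine ⟨hγ0, hlt, hl, hc, mul_ratio_le_of_le hL2 hγ0 hgap hc', by linarith, by linarith, ?_⟩
  have h1 : ((2 * A + 1) * l) ^ 2 ≤ (1 - ρ) ^ 2 := by
    have : (2 * A + 1) * l ≤ 1 - ρ := by linarith
    gcongr
  refine le_trans ?_ h1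
  have q4 : 0 ≤ (4 * A ^ 2 + 1) * l ^ 2 := by positivity
  linarith

namespace Problem

variable {n dx dy : ℕ} {Ξf Ξg : Type*} [MeasurableSpace Ξf] [MeasurableSpace Ξg]
variable {Q : Problem n dx dy Ξf Ξg} {L2 : ℝ≥0} {γ μ Flow w w' : ℝ}

theorem IsProxRegular.initialLevel_nonneg (h : Q.IsProxRegular L2 γ) (hF : ∀ z, Flow ≤ Q.F z)
    (hμ : 0 ≤ μ) (s : State n dx dy) : 0 ≤ Q.initialLevel γ μ Flow s := by
  have h1 := mul_nonneg hμ (sub_nonneg.2 (hF s.mean))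
  have h2 := h.moreau_le_G s.mean
  have h3 := s.consensusError_nonneg
  have h4 := sq_nonneg ‖avg s.θ - Q.proxPoint γ s.mean‖
  unfold initialLevel
  linarith

theorem IsProxRegular.lyapunov_le_initialLevel (h : Q.IsProxRegular L2 γ)
    (hF : ∀ z, Flow ≤ Q.F z) (hμ : 0 ≤ μ) (hw : w ≤ w') (hw' : 0 ≤ w') (s : State n dx dy) :
    Q.lyapunov γ μ Flow w s ≤ (1 + (L2 + 1 / γ) + w') * Q.initialLevel γ μ Flow s := by
  have h1 := mul_nonneg hμ (sub_nonneg.2 (hF s.mean))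
  have h2 := sub_nonneg.2 (h.moreau_le_G s.mean)
  have h3 := s.consensusError_nonneg
  have h4 := sq_nonneg ‖avg s.θ - Q.proxPoint γ s.mean‖
  have h5 := h.proxObjective_sub_moreau_le s.mean (avg s.θ)
  have h6 : w * s.consensusError ≤ w' * s.consensusError := by gcongr
  have hM : 0 ≤ (L2 : ℝ) + 1 / γ := by have := h.pos; positivity
  unfold lyapunov potential initialLevel
  generalize μ * (Q.F s.mean - Flow) = a at *
  have e : a + Q.G s.mean - Q.moreau γ s.mean = a + (Q.G s.mean - Q.moreau γ s.mean) := by ring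
  rw [e]
  generalize Q.G s.mean - Q.moreau γ s.mean = b at *
  generalize ‖avg s.θ - Q.proxPoint γ s.mean‖ ^ 2 = d at *
  generalize s.consensusError = Δ at *
  generalize (L2 : ℝ) + 1 / γ = M at *
  have p1 : 0 ≤ M * (a + b + Δ) := by positivity
  have p2 : 0 ≤ w' * (a + b + d) := by positivity
  linarith

end Problem

theorem integrable_and_sum_integral_le_of_lintegral {Ω : Type*} [MeasurableSpace Ω] {P : Measure Ω}
    {φ : ℕ → Ω → ℝ} {K : ℕ} {a b : ℝ} (hφ : ∀ k, Measurable (φ k)) (h0 : ∀ k ω, 0 ≤ φ k ω)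
    (ha : 0 < a) (hb : 0 ≤ b)
    (h : ∑ k ∈ Finset.range K, ∫⁻ ω, ENNReal.ofReal (a * φ k ω) ∂P ≤ ENNReal.ofReal b) :
    (∀ k < K, Integrable (φ k) P) ∧ a * ∑ k ∈ Finset.range K, ∫ ω, φ k ω ∂P ≤ b := by
  have hI : ∀ k < K, Integrable (fun ω => a * φ k ω) P := fun k hk => by
    refine ⟨((hφ k).const_mul a).aestronglyMeasurable, ?_⟩
    rw [hasFiniteIntegral_iff_ofReal
      (Filter.Eventually.of_forall fun ω => mul_nonneg ha.le (h0 k ω))]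
    refine lt_of_le_of_lt (le_trans ?_ h) ENNReal.ofReal_lt_top
    exact Finset.single_le_sum (f := fun k => ∫⁻ ω, ENNReal.ofReal (a * φ k ω) ∂P)
      (fun _ _ => zero_le) (Finset.mem_range.2 hk)
  refine ⟨fun k hk => ?_, ?_⟩
  · have := (hI k hk).const_mul a⁻¹
    refine this.congr (Filter.Eventually.of_forall fun ω => ?_)
    simp [ha.ne']
  · rw [Finset.mul_sum, ← ENNReal.ofReal_le_ofReal_iff hb,
      ENNReal.ofReal_sum_of_nonneg fun k _ => mul_nonneg ha.le (integral_nonneg (h0 k))]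
    refine le_trans (Finset.sum_le_sum fun k hk => le_of_eq ?_) h
    rw [← ofReal_integral_eq_lintegral_ofReal (hI k (Finset.mem_range.1 hk))
      (Filter.Eventually.of_forall fun ω => mul_nonneg ha.le (h0 k ω)), integral_const_mul]

end DSBO

end

theorem mainTheorem5
    (L1 L2 : ℝ≥0) (hL2 : 0 < L2)
    (γ : ℝ) (hγ : γ ∈ Set.Ioo (0 : ℝ) (1 / (2 * (L2 : ℝ))))
    (μ0 : ℝ) (hμ0 : 0 < μ0)
    (cl : ℝ) (hcl : 0 < cl)
    (hcl' : cl ≤ (1 / γ - L2) / (32 * DSBO.a1 L2 γ * DSBO.Lθ L2 γ ^ 2)) :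
    -- the threshold `τ` for the learning rate depends only on `L1, L2, γ, μ0, cl`
    ∃ τ : ℝ, 0 < τ ∧ ∀ cθ : ℝ, 0 < cθ →
    -- the constant in the rate depends only on `L1, L2, γ, μ0, cl, cθ`
    ∃ C : ℝ, 0 < C ∧
    ∀ (p δf δg σf σg D : ℝ), p ∈ Set.Ico (0 : ℝ) (1 / 4) →
      0 ≤ δf → 0 ≤ δg → 0 ≤ σf → 0 ≤ σg →
    ∀ (n dx dy : ℕ), 0 < n →
    ∀ (Ξf Ξg Ω : Type*) [MeasurableSpace Ξf] [MeasurableSpace Ξg] [MeasurableSpace Ω]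
      (P : Measure Ω) [IsProbabilityMeasure P]
      (Q : DSBO.Problem n dx dy Ξf Ξg) (Flow : ℝ),
      (∀ z, Flow ≤ Q.F z) →
      Q.IsSmooth L1 L2 →
      Q.IsStochasticOracle δf δg →
      Q.HasBoundedDissimilarity σf σg →
    ∀ (W : Matrix (Fin n) (Fin n) ℝ) (hW : DSBO.IsWeightMatrix W),
      DSBO.connectivity W hW.isHermitian < 1 →
    ∀ (ξf : Fin n → ℕ → Ω → Ξf) (ξg : Fin n → ℕ → Ω → Ξg), Q.IsSampling P ξf ξg →
    ∀ (s0 : DSBO.State n dx dy), Q.initialLevel γ μ0 Flow s0 ≤ D →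
    ∀ (K : ℕ), 1 ≤ K →
      cθ * √n / √K ≤ τ * (1 - DSBO.connectivity W hW.isHermitian) →
      let ρ : ℝ := DSBO.connectivity W hW.isHermitian
      let μ : ℕ → ℝ := fun k => μ0 * ((k : ℝ) + 1) ^ (-p)
      let lθ : ℕ → ℝ := fun _ => cθ * √n / √K
      let lxy : ℕ → ℝ := fun k => cl * lθ k
      let s : ℕ → Ω → DSBO.State n dx dy := fun k ω =>
        Q.sunDsboSE γ W μ lθ lxy lxy s0 (fun i j => ξf i j ω) (fun i j => ξg i j ω) k
      let C1 : ℝ := D + δf ^ 2 + δg ^ 2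
      (∀ k < K, Differentiable ℝ (Q.Psi γ (μ k)) ∧
        Integrable (fun ω => ‖∇ (Q.Psi γ (μ k)) (s k ω).mean‖ ^ 2) P) ∧
      1 / (K : ℝ) * ∑ k ∈ Finset.range K, ∫ ω, ‖∇ (Q.Psi γ (μ k)) (s k ω).mean‖ ^ 2 ∂P
        ≤ C * (C1 / (√n * √K)
          + n * (δf ^ 2 + δg ^ 2) / ((1 - ρ) ^ 2 * K)
          + n * (σf ^ 2 + σg ^ 2) / ((1 - ρ) ^ 2 * K)) := by
  have hγ0 : 0 < γ := hγ.1
  have hM := DSBO.smoothConst_pos (L1 := L1) (L2 := L2) hγ0 hμ0.le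
  have hA := DSBO.consensusConst_nonneg (L1 := L1) (L2 := L2) (γ := γ) (μ0 := μ0) (c := cl)
  have hB := DSBO.biasConst_nonneg (L1 := L1) (L2 := L2) (μ0 := μ0) hcl.le
  have hN := DSBO.noiseConst_pos (L1 := L1) (L2 := L2) (c := cl) hγ0 hμ0.le
  have hτ : 0 < DSBO.rateThreshold L1 L2 γ μ0 cl := by
    unfold DSBO.rateThreshold; positivity
  refine ⟨DSBO.rateThreshold L1 L2 γ μ0 cl, hτ, fun cθ hcθ => ?_⟩
  set E : ℝ := 1 + (L2 + 1 / γ) + 2 * DSBO.biasConst L1 L2 μ0 cl * DSBO.rateThreshold L1 L2 γ μ0 cl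
    with hE
  have hE0 : 0 < E := by positivity
  set H : ℝ := 4 * DSBO.biasConst L1 L2 μ0 cl * DSBO.consensusConst L1 L2 γ μ0 cl with hH
  have hH0 : 0 ≤ H := by positivity
  refine ⟨4 * E / (cl * cθ) + 8 * DSBO.noiseConst L1 L2 γ μ0 cl * cθ / cl + 8 * H * cθ ^ 2 / cl,
    by positivity, ?_⟩
  intro p δf δg σf σg D hp _ _ _ _ n dx dy hn Ξf Ξg Ω _ _ _ P _ Q Flow hF hQ hO hσ W hW hρ ξf ξg
    hS s0 hD K hK hl ρ μ lθ lxy s C1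
  have hK0 : (0 : ℝ) < K := by exact_mod_cast hK
  have hn0 : (0 : ℝ) < n := by exact_mod_cast hn
  have ha : 0 < √(n : ℝ) := Real.sqrt_pos.2 hn0
  have hb : 0 < √(K : ℝ) := Real.sqrt_pos.2 hK0
  have hl0 : 0 < cθ * √n / √K := by positivity
  have hρ0 : 0 ≤ ρ := DSBO.connectivity_nonneg hW.isHermitian
  have hr : 0 < 1 - ρ := sub_pos.2 hρ
  have hcond : DSBO.Problem.StepCondition L1 L2 γ μ0 cl (cθ * √n / √K) ρ :=
    DSBO.stepCondition_of_le_rateThreshold hL2 hγ hμ0 hcl hcl' hl0 hρ0 hρ hl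
  have hreg := hQ.isProxRegular hn hcond.γ_pos hcond.γ_lt
  have hμ : ∀ k, 0 ≤ μ k := fun k => by positivity
  have hμanti : Antitone μ := fun i j hij => by
    refine mul_le_mul_of_nonneg_left ?_ hμ0.le
    refine Real.rpow_le_rpow_of_nonpos (by positivity) ?_ (neg_nonpos.2 hp.1)
    have : (i : ℝ) ≤ j := by exact_mod_cast hij
    linarith
  have hμz : μ 0 = μ0 := by simp [μ]
  have hgrad : ∀ k, ∇ (Q.Psi γ (μ k)) = Q.gradPsi γ (μ k) := fun k =>
    funext fun z => (hreg.hasGradientAt_Psi hQ.differentiable_F z).gradient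
  have hsum := hQ.lintegral_lyapunov_add_sum_le hO hn hF hσ hW hρ hcond hμ hμanti hμz.le hS s0 K
  have hs : ∀ k, Measurable (s k) := fun k => hO.measurable_sunDsboSE μ _ _ _ s0 k
    (fun i j _ => hS.measurable_f i j) fun i j _ => hS.measurable_g i j
  have hφ : ∀ k, Measurable fun ω => ‖Q.gradPsi γ (μ k) (s k ω).mean‖ ^ 2 := fun k =>
    ((hreg.continuous_gradPsi (hQ.lipschitz_F hn)).measurable.comp
      (DSBO.State.measurable_mean.comp (hs k))).norm.pow_const 2
  have hD0 : 0 ≤ D := (hreg.initialLevel_nonneg hF hμ0.le s0).trans hD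
  have hlyap : Q.lyapunov γ (μ 0) Flow
      (2 * DSBO.biasConst L1 L2 μ0 cl * (cθ * √n / √K) / (1 - ρ)) s0 ≤ E * D := by
    rw [hμz]
    refine (hreg.lyapunov_le_initialLevel hF hμ0.le ?_ (by positivity) s0).trans
      (mul_le_mul_of_nonneg_left hD hE0.le)
    rw [div_le_iff₀ hr, mul_assoc _ _ (1 - ρ)]
    gcongr
  set R := DSBO.noiseConst L1 L2 γ μ0 cl * (cθ * √n / √K) ^ 2 * ((δf ^ 2 + 2 * δg ^ 2) / n)
    + H * (cθ * √n / √K) ^ 3 / (1 - ρ) ^ 2 * (σf ^ 2 + σg ^ 2 + (δf ^ 2 + 2 * δg ^ 2)) with hR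
  have hR0 : 0 ≤ R := by positivity
  obtain ⟨hint, hle⟩ := DSBO.integrable_and_sum_integral_le_of_lintegral (P := P) (K := K)
    (a := cl * (cθ * √n / √K) / 4) (b := E * D + K * R) hφ (fun k ω => sq_nonneg _)
    (by positivity) (by positivity) <| by
      refine (le_trans le_add_self hsum).trans ?_
      rw [ENNReal.ofReal_add (p := E * D) (q := K * R) (by positivity) (by positivity),
        ENNReal.ofReal_mul hK0.le,
        ENNReal.ofReal_natCast]
      exact add_le_add_left (ENNReal.ofReal_le_ofReal hlyap) _
  refine ⟨fun k hk => ⟨DSBO.differentiable_of_hasGradientAt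
    (hreg.hasGradientAt_Psi hQ.differentiable_F), ?_⟩, ?_⟩
  · rw [hgrad k]
    exact hint k hk
  · simp only [hgrad]
    have hna : √(n : ℝ) ^ 2 = n := Real.sq_sqrt hn0.le
    have hKb : √(K : ℝ) ^ 2 = K := Real.sq_sqrt hK0.le
    have := DSBO.rate_of_accumulated_decrease (S := ∑ k ∈ Finset.range K,
        ∫ ω, ‖Q.gradPsi γ (μ k) (s k ω).mean‖ ^ 2 ∂P) (δ := δf ^ 2 + δg ^ 2)
      (σ := σf ^ 2 + σg ^ 2) (V := δf ^ 2 + 2 * δg ^ 2) hcl hcθ ha hb hr hE0.le hN.le hH0 hD0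
      (by positivity) (by positivity) (by linarith [sq_nonneg δf]) rfl
      (by rw [hna, hKb]; exact hle)
    rw [hna, hKb, ← add_assoc D] at this
    exact this
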